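/- Let $a:\mathbb{R}\to\mathbb{R}$ be a convolution kernel with the following properties: $a\in L^1(\mathbb{R})\cap L^2(\mathbb{R})$ with $\int_{\mathbb{R}}a(x)\,dx=1$; $a$ is even, nonnegative and unimodal, i.e. $a(x)=a(-x)$ for almost all $x$ and $a(x)\ge a(\tilde x)\ge 0$ for almost all $0<x<\tilde x$; and $a$ is continuous on $\mathbb{R}$, differentiable at every $x>0$ (differentiability at the origin is allowed but not required), with $a'(x)<0$ for all $x>0$. For $0<\xi<\infty$ let $\chi_\xi$ be the indicator function of $I_\xi=[-\xi,\xi]$, let $L^2_{\rm odd}(\mathbb{R})$ be the space of odd real-valued square-integrable functions, and let $\mathcal{A}_\xi v=\chi_\xi\cdot\bigl(a*(\chi_\xi\cdot v)\bigr)$ for $v\in L^2_{\rm odd}(\mathbb{R})$, which defines a linear operator on $L^2_{\rm odd}(\mathbb{R})$. Let $\mathcal{N}=\{v\in L^2(\mathbb{R}): v(x)=-v(-x) \text{ and } v(x)\le 0 \text{ for almost all } x>0\}$ and $$\widetilde{\mathcal{N}}_\xi=\bigl\{v\in\mathcal{N}\cap C^1(I_\xi): v'(0)<0,\ v(x)<0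 \text{ for } 0<x\le\xi,\ v(x)=0 \text{ for } x>\xi\bigr\},$$ where an element of $L^2(\mathbb{R})$ belongs to $\widetilde{\mathcal{N}}_\xi$ if it has an odd representative with the stated pointwise properties. Then, for every $0<\xi<\infty$, the operator $\mathcal{A}_\xi$ in $L^2_{\rm odd}(\mathbb{R})$ has a largest eigenvalue $\lambda_\xi$. This eigenvalue is simple (its generalized eigenspace $\bigcup_{k}\ker(\mathcal{A}_\xi-\lambda_\xi)^k$ is one-dimensional), and the eigenspace of $\lambda_\xi$ is spanned by an eigenfunction $v_\xi\in\widetilde{\mathcal{N}}_\xi$ with $\|v_\xi\|_2=1$. Moreover, $v_\xi$ is the only eigenfunction to $\lambda_\xi$ that belongs to $\widetilde{\mathcal{N}}_\xi$ and has $L^2$-norm one. -/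

import Mathlib

open MeasureTheory

noncomputable section

namespace KreinRutman

/-- The space `L²(ℝ)` of (classes of) real-valued square-integrable functions. -/
abbrev L2 : Type := Lp ℝ 2 (volume : Measure ℝ)

/-- The cone `𝒰` of even, nonnegative and unimodal `L²` functions. -/
def coneU : Set (ℝ → ℝ) :=
  {u | MemLp u 2 volume ∧ (∀ᵐ x : ℝ, u x = u (-x)) ∧
    ∀ᵐ p : ℝ × ℝ, 0 < p.1 → p.1 < p.2 → u p.2 ≤ u p.1 ∧ 0 ≤ u p.2}

/-- Admissible convolution kernels: normalized, integrable, strictly unimodal elements of `𝒰`.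
A kernel is continuous on `ℝ` and differentiable away from the origin (recall that it is even);
differentiability at the origin itself is allowed but not required. -/
structure IsKernel (a : ℝ → ℝ) : Prop where
  mem_coneU : a ∈ coneU
  integrable : Integrable a volume
  integral_eq_one : ∫ x, a x = 1
  continuous : Continuous a
  differentiableAt : ∀ x, 0 < x → DifferentiableAt ℝ a x
  deriv_neg : ∀ x, 0 < x → deriv a x < 0

/-- Multiplication by the indicator function `χ_ξ` of the interval `[-ξ, ξ]`. -/
def cutoff (ξ : ℝ) (v : ℝ → ℝ) : ℝ → ℝ := (Set.Icc (-ξ) ξ).indicator v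

/-- The function `χ_ξ · (a ∗ (χ_ξ · v))`. -/
def modConv (a : ℝ → ℝ) (ξ : ℝ) (v : ℝ → ℝ) : ℝ → ℝ :=
  cutoff ξ (convolution a (cutoff ξ v) (ContinuousLinearMap.mul ℝ ℝ) volume)

theorem memLp_cutoff (ξ : ℝ) {v : ℝ → ℝ} (hv : MemLp v 2 volume) :
    MemLp (cutoff ξ v) 2 volume :=
  hv.indicator measurableSet_Icc

theorem cutoff_congr (ξ : ℝ) {v w : ℝ → ℝ} (h : v =ᵐ[volume] w) :
    cutoff ξ v =ᵐ[volume] cutoff ξ w := by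
  filter_upwards [h] with x hx
  simp [cutoff, Set.indicator, hx]

theorem memLp_reflect {g : ℝ → ℝ} (hg : MemLp g 2 volume) (x : ℝ) :
    MemLp (fun t => g (x - t)) 2 volume :=
  hg.comp_measurePreserving (Measure.measurePreserving_sub_left volume x)

theorem convolutionExists {a g : ℝ → ℝ} (ha : MemLp a 2 volume) (hg : MemLp g 2 volume) :
    ConvolutionExists a g (ContinuousLinearMap.mul ℝ ℝ) volume := fun x =>
  MemLp.integrable_mul ha (memLp_reflect hg x)

theorem enorm_convolution_le {a g : ℝ → ℝ} (ha : MemLp a 2 volume) (hg : MemLp g 2 volume)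
    (x : ℝ) : ‖convolution a g (ContinuousLinearMap.mul ℝ ℝ) volume x‖ₑ ≤
      eLpNorm a 2 volume * eLpNorm g 2 volume := by
  have h1 : eLpNorm (fun t => g (x - t)) 2 volume = eLpNorm g 2 volume :=
    eLpNorm_comp_measurePreserving hg.1 (Measure.measurePreserving_sub_left volume x)
  have h2 : eLpNorm (a • fun t => g (x - t)) 1 volume ≤
      eLpNorm a 2 volume * eLpNorm (fun t => g (x - t)) 2 volume :=
    eLpNorm_smul_le_mul_eLpNorm (memLp_reflect hg x).1 ha.1
  rw [h1, eLpNorm_one_eq_lintegral_enorm] at h2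
  rw [convolution_def]
  exact (enorm_integral_le_lintegral_enorm _).trans h2

theorem memLp_modConv {a v : ℝ → ℝ} (ha : MemLp a 2 volume) (ξ : ℝ) (hv : MemLp v 2 volume) :
    MemLp (modConv a ξ v) 2 volume := by
  have hg := memLp_cutoff ξ hv
  set C := (eLpNorm a 2 volume * eLpNorm (cutoff ξ v) 2 volume).toReal with hC
  have hfin : eLpNorm a 2 volume * eLpNorm (cutoff ξ v) 2 volume ≠ ⊤ :=
    ENNReal.mul_ne_top ha.2.ne hg.2.ne
  have hmeas : AEStronglyMeasurable
      (convolution a (cutoff ξ v) (ContinuousLinearMap.mul ℝ ℝ) volume) volume :=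
    (ha.1.convolution_integrand (ContinuousLinearMap.mul ℝ ℝ) hg.1).integral_prod_right'
  have hconst : MemLp ((Set.Icc (-ξ) ξ).indicator fun _ => C) 2 (volume : Measure ℝ) :=
    memLp_indicator_const 2 measurableSet_Icc C (Or.inr measure_Icc_lt_top.ne)
  refine hconst.mono (hmeas.indicator measurableSet_Icc) (Filter.Eventually.of_forall fun x => ?_)
  by_cases hx : x ∈ Set.Icc (-ξ) ξ
  · simp only [modConv, cutoff, Set.indicator_of_mem hx]
    refine le_trans ?_ (le_abs_self _)
    have h := ENNReal.toReal_mono hfin (enorm_convolution_le ha hg x)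
    rw [toReal_enorm] at h
    exact h
  · simp [modConv, cutoff, Set.indicator_of_notMem hx]

theorem modConv_congr (a : ℝ → ℝ) (ξ : ℝ) {v w : ℝ → ℝ} (h : v =ᵐ[volume] w) :
    modConv a ξ v = modConv a ξ w := by
  unfold modConv
  rw [convolution_congr (ContinuousLinearMap.mul ℝ ℝ) (Filter.EventuallyEq.refl _ a)
    (cutoff_congr ξ h)]

theorem modConv_add {a v w : ℝ → ℝ} (ha : MemLp a 2 volume) (ξ : ℝ) (hv : MemLp v 2 volume)
    (hw : MemLp w 2 volume) : modConv a ξ (v + w) = modConv a ξ v + modConv a ξ w := by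
  unfold modConv
  have h : cutoff ξ (v + w) = cutoff ξ v + cutoff ξ w := Set.indicator_add' _ _ _
  rw [h, (convolutionExists ha (memLp_cutoff ξ hv)).distrib_add
    (convolutionExists ha (memLp_cutoff ξ hw))]
  exact Set.indicator_add' _ _ _

theorem modConv_smul (a : ℝ → ℝ) (ξ c : ℝ) (v : ℝ → ℝ) :
    modConv a ξ (c • v) = c • modConv a ξ v := by
  unfold modConv
  have h : cutoff ξ (c • v) = c • cutoff ξ v := Set.indicator_const_smul _ c _
  rw [h, convolution_smul]
  exact Set.indicator_const_smul _ c _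

/-- The operator `v ↦ χ_ξ · (a ∗ (χ_ξ · v))` as a linear map from `L²(ℝ)` to itself. -/
def modConvL2 (a : ℝ → ℝ) (ha : MemLp a 2 volume) (ξ : ℝ) : L2 →ₗ[ℝ] L2 where
  toFun v := (memLp_modConv ha ξ (Lp.memLp v)).toLp (modConv a ξ v)
  map_add' v w := by
    rw [← MemLp.toLp_add]
    refine MemLp.toLp_congr _ _ (Filter.EventuallyEq.of_eq ?_)
    rw [modConv_congr a ξ (Lp.coeFn_add v w), modConv_add ha ξ (Lp.memLp v) (Lp.memLp w)]
  map_smul' c v := by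
    rw [RingHom.id_apply, ← MemLp.toLp_const_smul]
    refine MemLp.toLp_congr _ _ (Filter.EventuallyEq.of_eq ?_)
    rw [modConv_congr a ξ (Lp.coeFn_smul c v), modConv_smul]

theorem ae_neg {p : ℝ → Prop} (h : ∀ᵐ x : ℝ, p x) : ∀ᵐ x : ℝ, p (-x) :=
  (Measure.measurePreserving_neg (volume : Measure ℝ)).quasiMeasurePreserving.ae h

/-- The space `L²_odd(ℝ)` of odd square-integrable functions, with the `L²` norm. -/
def oddL2 : Submodule ℝ L2 where
  carrier := {v | ∀ᵐ x : ℝ, v (-x) = -v x}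
  add_mem' := by
    intro v w hv hw
    have hv' : ∀ᵐ x : ℝ, v (-x) = -v x := hv
    have hw' : ∀ᵐ x : ℝ, w (-x) = -w x := hw
    have h := Lp.coeFn_add v w
    filter_upwards [hv', hw', h, ae_neg h] with x h1 h2 h3 h4
    simp only [Pi.add_apply] at h3 h4
    rw [h3, h4, h1, h2]
    ring
  zero_mem' := by
    have h := Lp.coeFn_zero ℝ 2 (volume : Measure ℝ)
    change ∀ᵐ x : ℝ, (0 : L2) (-x) = -(0 : L2) x
    filter_upwards [h, ae_neg h] with x h1 h2
    rw [h1, h2]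
    simp
  smul_mem' := by
    intro c v hv
    have hv' : ∀ᵐ x : ℝ, v (-x) = -v x := hv
    have h := Lp.coeFn_smul c v
    filter_upwards [hv', h, ae_neg h] with x h1 h2 h3
    simp only [Pi.smul_apply, smul_eq_mul] at h2 h3
    rw [h2, h3, h1]
    ring

theorem modConv_odd {a v : ℝ → ℝ} (ha : ∀ᵐ x : ℝ, a x = a (-x)) (ξ : ℝ)
    (hv : ∀ᵐ x : ℝ, v (-x) = -v x) (x : ℝ) : modConv a ξ v (-x) = -modConv a ξ v x := by
  have hg : ∀ᵐ y : ℝ, cutoff ξ v (-y) = -cutoff ξ v y := by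
    filter_upwards [hv] with y hy
    have hiff : -y ∈ Set.Icc (-ξ) ξ ↔ y ∈ Set.Icc (-ξ) ξ := by
      simp only [Set.mem_Icc]
      constructor <;> rintro ⟨h1, h2⟩ <;> constructor <;> linarith
    by_cases h : y ∈ Set.Icc (-ξ) ξ
    · simp [cutoff, Set.indicator_of_mem h, Set.indicator_of_mem (hiff.2 h), hy]
    · simp [cutoff, Set.indicator_of_notMem h, Set.indicator_of_notMem (mt hiff.1 h)]
  have hconv : convolution a (cutoff ξ v) (ContinuousLinearMap.mul ℝ ℝ) volume (-x) =
      -convolution a (cutoff ξ v) (ContinuousLinearMap.mul ℝ ℝ) volume x := by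
    rw [convolution_def, convolution_def, ← integral_neg, ← integral_neg_eq_self]
    refine integral_congr_ae ?_
    have hg' := (Measure.measurePreserving_sub_left (volume : Measure ℝ) x
      ).quasiMeasurePreserving.ae hg
    filter_upwards [ha, hg'] with t h1 h2
    simp only [ContinuousLinearMap.mul_apply']
    rw [← h1, show -x - -t = -(x - t) by ring, h2]
    ring
  have hiff : -x ∈ Set.Icc (-ξ) ξ ↔ x ∈ Set.Icc (-ξ) ξ := by
    simp only [Set.mem_Icc]
    constructor <;> rintro ⟨h1, h2⟩ <;> constructor <;> linarith
  by_cases h : x ∈ Set.Icc (-ξ) ξ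
  · simpa only [modConv, cutoff, Set.indicator_of_mem h, Set.indicator_of_mem (hiff.2 h)]
      using hconv
  · simp [modConv, cutoff, Set.indicator_of_notMem h, Set.indicator_of_notMem (mt hiff.1 h)]

theorem modConvL2_mem_oddL2 {a : ℝ → ℝ} (ha : IsKernel a) (ξ : ℝ) :
    ∀ v ∈ oddL2, modConvL2 a ha.mem_coneU.1 ξ v ∈ oddL2 := by
  intro v hv
  have h := MemLp.coeFn_toLp (memLp_modConv ha.mem_coneU.1 ξ (Lp.memLp v))
  change ∀ᵐ x : ℝ, modConvL2 a ha.mem_coneU.1 ξ v (-x) = -modConvL2 a ha.mem_coneU.1 ξ v x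
  filter_upwards [h, ae_neg h] with x h1 h2
  exact h2.trans ((modConv_odd ha.mem_coneU.2.1 ξ hv x).trans (congrArg Neg.neg h1.symm))

/-- The operator `𝒜_ξ v = χ_ξ · (a ∗ (χ_ξ · v))` acting in `L²_odd(ℝ)`. -/
def opA (a : ℝ → ℝ) (ha : IsKernel a) (ξ : ℝ) : Module.End ℝ oddL2 :=
  (modConvL2 a ha.mem_coneU.1 ξ).restrict (modConvL2_mem_oddL2 ha ξ)

/-- The cone `𝒩` of odd `L²` functions that are nonpositive on the positive half-axis. -/
def coneN : Set L2 :=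
  {v | (∀ᵐ x : ℝ, v x = -v (-x)) ∧ ∀ᵐ x : ℝ, 0 < x → v x ≤ 0}

/-- The cone `𝒩̃_ξ`: the elements of `𝒩` that have an odd representative which is `C¹` on
`[-ξ, ξ]`, has negative derivative at the origin, is negative on `(0, ξ]` and vanishes on
`(ξ, ∞)`. -/
def coneNtilde (ξ : ℝ) : Set L2 :=
  {v | v ∈ coneN ∧ ∃ f : ℝ → ℝ, v =ᵐ[volume] f ∧ (∀ x, f (-x) = -f x) ∧
    ContDiffOn ℝ 1 f (Set.Icc (-ξ) ξ) ∧ deriv f 0 < 0 ∧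
    (∀ x, 0 < x → x ≤ ξ → f x < 0) ∧ ∀ x, ξ < x → f x = 0}

end KreinRutman

end

/-! The mechanism is that of Jentzsch's theorem, with positivity exploited through the quadratic
form. On odd functions the operator folds onto $(0,\xi]$ and becomes an integral operator with
kernel $a(x-y)-a(x+y)$. Since $a$ is even and strictly decreasing on the half-line, this kernel is
strictly positive for $x,y>0$ (`IsKernel.halfline_pos`).

The operator is compact and symmetric, and its quadratic form takes a positive value, so the
supremum $\lambda$ of the Rayleigh quotient is positive and attained at an eigenvector
(`exists_eigenvector_rayleigh_le`); every eigenvalue is a Rayleigh quotient, hence at most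
$\lambda$. Replacing $v$ by $-\operatorname{sign}(x)|v|$ keeps the norm and does not lower the
quadratic form (`inner_opA_le_negAbsOdd`), so it maps maximizers to maximizers and yields an
eigenfunction in the cone. Positivity of the kernel makes such an eigenfunction strictly negative on
$(0,\xi]$ (`modConv_neg`).

The same argument gives every eigenfunction to $\lambda$ a strict sign on $(0,\xi]$
(`eigenvector_sign`). Two functions of strict sign are never orthogonal, so the eigenspace is a line
(`eigenspace_eq_span`); symmetry excludes further generalized eigenvectors. Regularity and $v'(0)<0$
follow from $v=\lambda^{-1}\,a*v$ on $[-\xi,\xi]$ (`eigenvector_mem_coneNtilde`). -/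

namespace KreinRutman

open scoped RealInnerProductSpace

/-! ### Rayleigh quotients of symmetric operators -/

/-- A positive symmetric operator satisfies `‖P v‖² ≤ ‖P‖ ⟪P v, v⟫`. -/
theorem norm_sq_apply_le_of_nonneg {E : Type*} [NormedAddCommGroup E] [InnerProductSpace ℝ E]
    (P : E →L[ℝ] E) (hs : (P : E →ₗ[ℝ] E).IsSymmetric) (hP : ∀ v, 0 ≤ ⟪P v, v⟫) (v : E) :
    ‖P v‖ ^ 2 ≤ ‖P‖ * ⟪P v, v⟫ := by
  rcases (norm_nonneg P).eq_or_lt with h0 | h0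
  · have : P = 0 := norm_eq_zero.1 h0.symm
    simp [this]
  -- A gradient step of length `‖P‖⁻¹`: after expansion the quadratic term is at most `‖P‖⁻¹ * ‖P v‖
  -- ^ 2`, half of what the cross terms subtract.
  have h1 := hP (v - ‖P‖⁻¹ • P v)
  have h2 : ⟪P (P v), v⟫ = ‖P v‖ ^ 2 := by
    rw [← real_inner_self_eq_norm_sq]
    exact hs (P v) v
  have h3 : ⟪P (P v), P v⟫ ≤ ‖P‖ * ‖P v‖ ^ 2 := by
    refine (real_inner_le_norm _ _).trans ?_
    rw [sq, ← mul_assoc]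
    gcongr
    exact P.le_opNorm _
  simp only [map_sub, map_smul, inner_sub_left, inner_sub_right, real_inner_smul_left,
    real_inner_smul_right, h2, real_inner_self_eq_norm_sq] at h1
  have h4 : ‖P‖⁻¹ * (‖P‖⁻¹ * ⟪P (P v), P v⟫) ≤ ‖P‖⁻¹ * ‖P v‖ ^ 2 := by
    gcongr
    rw [inv_mul_le_iff₀ h0]
    exact h3
  have h5 : ‖P‖⁻¹ * ‖P v‖ ^ 2 ≤ ⟪P v, v⟫ := by linarith
  rwa [inv_mul_le_iff₀ h0] at h5

/-- If `lam` bounds the Rayleigh quotient of `T`, the defect of the Rayleigh quotient of `v`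
controls the residual `T v - lam • v`. -/
theorem norm_sq_residual_le {E : Type*} [NormedAddCommGroup E] [InnerProductSpace ℝ E]
    (T : E →L[ℝ] E) (hs : (T : E →ₗ[ℝ] E).IsSymmetric) {lam : ℝ}
    (hle : ∀ v, ⟪T v, v⟫ ≤ lam * ‖v‖ ^ 2) (v : E) :
    ‖T v - lam • v‖ ^ 2 ≤ ‖lam • ContinuousLinearMap.id ℝ E - T‖ * (lam * ‖v‖ ^ 2 - ⟪T v, v⟫) := by
  set P : E →L[ℝ] E := lam • ContinuousLinearMap.id ℝ E - T with hPdef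
  have hP : ∀ w, ⟪P w, w⟫ = lam * ‖w‖ ^ 2 - ⟪T w, w⟫ := fun w => by
    simp [hPdef, inner_sub_left, real_inner_smul_left]
  have hPs : (P : E →ₗ[ℝ] E).IsSymmetric := fun x y => by
    have := hs x y
    simp only [ContinuousLinearMap.coe_coe] at this
    simp [hPdef, inner_sub_left, inner_sub_right, real_inner_smul_left, real_inner_smul_right, this]
  have h := norm_sq_apply_le_of_nonneg P hPs (fun w => by rw [hP]; linarith [hle w]) v
  rw [hP] at h
  rw [norm_sub_rev]
  simpa [hPdef] using h

/-- If `lam` bounds the Rayleigh quotient of a symmetric operator `T` and is attained at `v`, then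
`T v = lam • v`. -/
theorem apply_eq_smul_of_rayleigh_le {E : Type*} [NormedAddCommGroup E] [InnerProductSpace ℝ E]
    (T : E →L[ℝ] E) (hs : (T : E →ₗ[ℝ] E).IsSymmetric) {lam : ℝ}
    (hle : ∀ v, ⟪T v, v⟫ ≤ lam * ‖v‖ ^ 2) {v : E} (hv : lam * ‖v‖ ^ 2 ≤ ⟪T v, v⟫) :
    T v = lam • v := by
  have h0 : ‖T v - lam • v‖ ^ 2 ≤ 0 :=
    (norm_sq_residual_le T hs hle v).trans
      (mul_nonpos_of_nonneg_of_nonpos (norm_nonneg _) (by linarith))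
  have h1 := pow_eq_zero_iff two_ne_zero |>.1 (le_antisymm h0 (sq_nonneg _))
  exact sub_eq_zero.1 (norm_eq_zero.1 h1)

/-- A compact symmetric operator that takes a positive value in its quadratic form attains the
supremum of its Rayleigh quotient at an eigenvector. -/
theorem exists_eigenvector_rayleigh_le {E : Type*} [NormedAddCommGroup E] [InnerProductSpace ℝ E]
    [CompleteSpace E] (T : E →L[ℝ] E) (hc : IsCompactOperator T)
    (hs : (T : E →ₗ[ℝ] E).IsSymmetric) {u : E} (hu : 0 < ⟪T u, u⟫) :
    ∃ lam : ℝ, 0 < lam ∧ (∃ v, v ≠ 0 ∧ T v = lam • v) ∧ ∀ v, ⟪T v, v⟫ ≤ lam * ‖v‖ ^ 2 := by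
  have hu0 : u ≠ 0 := by
    rintro rfl
    simp at hu
  have hun : 0 < ‖u‖ := norm_pos_iff.2 hu0
  set S : Set ℝ := {r | ∃ v : E, ‖v‖ = 1 ∧ ⟪T v, v⟫ = r} with hS
  have hbdd : BddAbove S := by
    refine ⟨‖T‖, ?_⟩
    rintro r ⟨v, hv, rfl⟩
    refine (real_inner_le_norm _ _).trans ?_
    simpa [hv] using T.le_opNorm v
  have hscale : ∀ v : E, v ≠ 0 → ⟪T v, v⟫ / ‖v‖ ^ 2 ∈ S := fun v hv => by
    have hvn : ‖v‖ ≠ 0 := norm_ne_zero_iff.2 hv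
    refine ⟨‖v‖⁻¹ • v, by simp [norm_smul, hvn], ?_⟩
    rw [map_smul, real_inner_smul_left, real_inner_smul_right]
    field_simp
  have hle : ∀ v, ⟪T v, v⟫ ≤ sSup S * ‖v‖ ^ 2 := fun v => by
    rcases eq_or_ne v 0 with rfl | hv
    · simp
    · have hvn : 0 < ‖v‖ := norm_pos_iff.2 hv
      rw [← div_le_iff₀ (by positivity)]
      exact le_csSup hbdd (hscale v hv)
  have hpos : 0 < sSup S := lt_of_lt_of_le (by positivity) (le_csSup hbdd (hscale u hu0))
  refine ⟨sSup S, hpos, ?_, hle⟩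
  by_contra hno
  have hne : ¬ Module.End.HasEigenvalue (T : Module.End ℝ E) (sSup S) := fun h => by
    obtain ⟨v, hv⟩ := h.exists_hasEigenvector
    exact hno ⟨v, hv.2, hv.apply_eq_smul⟩
  -- Compactness enters here (Fredholm alternative): a nonzero number that is not an eigenvalue
  -- leaves `T v - sSup S • v` bounded below by `c * ‖v‖`.
  obtain ⟨c, hc0, hcle⟩ := antilipschitzWith_iff_exists_mul_le_norm.1
    (hc.antilipschitz_of_not_hasEigenvalue hpos.ne' hne)
  set M := ‖sSup S • ContinuousLinearMap.id ℝ E - T‖ with hM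
  have hM0 : 0 ≤ M := norm_nonneg _
  -- A near-maximizer has a small residual. With defect below `c ^ 2 / (M + 1)` the squared residual
  -- falls below `c ^ 2`; the `+ 1` covers `M = 0`.
  obtain ⟨r, ⟨v, hv, rfl⟩, hr⟩ := exists_lt_of_lt_csSup (⟨_, hscale u hu0⟩ : S.Nonempty)
    (show sSup S - c ^ 2 / (M + 1) < sSup S from sub_lt_self _ (by positivity))
  have h1 := norm_sq_residual_le T hs hle v
  have h2 : c ≤ ‖T v - sSup S • v‖ := by simpa [hv] using hcle v
  have h3 : c ^ 2 ≤ M * (sSup S - ⟪T v, v⟫) := by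
    calc c ^ 2 ≤ ‖T v - sSup S • v‖ ^ 2 := by gcongr
      _ ≤ _ := by simpa [hv] using h1
  have h4 : M * (sSup S - ⟪T v, v⟫) ≤ M * (c ^ 2 / (M + 1)) := by
    gcongr
    linarith
  have h5 : M * (c ^ 2 / (M + 1)) < c ^ 2 := by
    rw [← mul_div_assoc, div_lt_iff₀ (by positivity)]
    nlinarith [pow_pos hc0 2]
  linarith

/-! ### Pointwise properties of the kernel and its derivative -/

theorem IsKernel.even {a : ℝ → ℝ} (ha : IsKernel a) (x : ℝ) : a (-x) = a x := by
  have h := (Continuous.ae_eq_iff_eq (volume : Measure ℝ) ha.continuous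
    (ha.continuous.comp continuous_neg)).1 ha.mem_coneU.2.1
  exact (congrFun h x).symm

theorem IsKernel.strictAntiOn {a : ℝ → ℝ} (ha : IsKernel a) : StrictAntiOn a (Set.Ici 0) := by
  refine strictAntiOn_of_deriv_neg (convex_Ici 0) ha.continuous.continuousOn fun x hx => ?_
  rw [interior_Ici] at hx
  exact ha.deriv_neg x hx

theorem IsKernel.lt_of_abs_lt {a : ℝ → ℝ} (ha : IsKernel a) {x y : ℝ} (h : |x| < |y|) :
    a y < a x := by
  have habs : ∀ z, a |z| = a z := fun z => by
    rcases abs_choice z with h | h <;> rw [h]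
    exact ha.even z
  rw [← habs x, ← habs y]
  exact ha.strictAntiOn (abs_nonneg x) (abs_nonneg y) h

/-- The almost-everywhere condition holds on a dense set of pairs. A negative value at `x` would, by
strict monotonicity, give negative values on the open set of pairs with second entry beyond `|x|`.
-/
theorem IsKernel.nonneg {a : ℝ → ℝ} (ha : IsKernel a) (x : ℝ) : 0 ≤ a x := by
  by_contra! hx
  set U : Set (ℝ × ℝ) := {p | 0 < p.1 ∧ p.1 < p.2 ∧ |x| < p.2} with hU
  have hopen : IsOpen U := by
    refine (isOpen_lt continuous_const continuous_fst).inter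
      ((isOpen_lt continuous_fst continuous_snd).inter (isOpen_lt continuous_const continuous_snd))
  have hne : U.Nonempty := ⟨(1, |x| + 2), by simp [hU]; linarith [abs_nonneg x]⟩
  have hd := Measure.dense_of_ae (show ∀ᵐ p : ℝ × ℝ ∂(volume : Measure (ℝ × ℝ)), _ from
    ha.mem_coneU.2.2)
  obtain ⟨p, hp, hpU⟩ := hd.exists_mem_open hopen hne
  have h1 := (hp hpU.1 hpU.2.1).2
  have h2 : a p.2 < a x := ha.lt_of_abs_lt (hpU.2.2.trans_le (le_abs_self _))
  linarith

theorem IsKernel.le_zero {a : ℝ → ℝ} (ha : IsKernel a) (x : ℝ) : a x ≤ a 0 := by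
  rcases eq_or_ne x 0 with rfl | hx
  · exact le_rfl
  · exact (ha.lt_of_abs_lt (by simpa using hx)).le

theorem IsKernel.norm_le {a : ℝ → ℝ} (ha : IsKernel a) (x : ℝ) : ‖a x‖ ≤ a 0 := by
  rw [Real.norm_of_nonneg (ha.nonneg x)]
  exact ha.le_zero x

theorem IsKernel.deriv_odd {a : ℝ → ℝ} (ha : IsKernel a) (x : ℝ) :
    deriv a (-x) = -deriv a x := by
  have h : (fun x => a (-x)) = a := funext ha.even
  have h1 := deriv_comp_neg a x
  rw [h] at h1
  linarith

theorem IsKernel.hasDerivAt {a : ℝ → ℝ} (ha : IsKernel a) {x : ℝ} (hx : x ≠ 0) :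
    HasDerivAt a (deriv a x) x := by
  rcases lt_or_gt_of_ne hx with h | h
  · have h1 : DifferentiableAt ℝ (fun x => a (-x)) x :=
      (ha.differentiableAt (-x) (by linarith)).comp x differentiableAt_id.neg
    rw [funext ha.even] at h1
    exact h1.hasDerivAt
  · exact (ha.differentiableAt x h).hasDerivAt

/-- The derivative has constant sign on the half-line and its primitive `a` converges at infinity,
being monotone and bounded below. Oddness of the derivative handles the other side. -/
theorem IsKernel.integrable_deriv {a : ℝ → ℝ} (ha : IsKernel a) :
    Integrable (deriv a) volume := by
  have hlim : ∃ l, Filter.Tendsto a Filter.atTop (nhds l) := by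
    -- Freezing `a` to the left of the origin makes it antitone on the whole line without changing
    -- its limit.
    have hanti : Antitone fun x : ℝ => a (max x 0) := fun x y hxy =>
      ha.strictAntiOn.antitoneOn (Set.mem_Ici.2 (le_max_right x 0))
        (Set.mem_Ici.2 (le_max_right y 0)) (max_le_max_right 0 hxy)
    have h := tendsto_atTop_ciInf hanti ⟨0, by rintro _ ⟨x, rfl⟩; exact ha.nonneg _⟩
    refine ⟨_, h.congr' ?_⟩
    filter_upwards [Filter.eventually_ge_atTop 0] with x hx
    rw [max_eq_left hx]
  obtain ⟨l, hl⟩ := hlim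
  have hpos : IntegrableOn (deriv a) (Set.Ioi 0) :=
    integrableOn_Ioi_deriv_of_nonpos ha.continuous.continuousWithinAt
      (fun x hx => ha.hasDerivAt (ne_of_gt hx)) (fun x hx => (ha.deriv_neg x hx).le) hl
  have hneg : IntegrableOn (deriv a) (Set.Iio 0) := by
    have h := hpos.comp_neg.neg
    have hfun : (-fun x => deriv a (-x)) = deriv a := by
      ext x
      simp [ha.deriv_odd]
    rw [hfun] at h
    simpa using h
  have := ((integrableOn_Iic_iff_integrableOn_Iio).2 hneg).union hpos
  rwa [Set.Iic_union_Ioi, integrableOn_univ] at this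

theorem IsKernel.integral_deriv {a : ℝ → ℝ} (ha : IsKernel a) (x y : ℝ) :
    ∫ t in x..y, deriv a t = a y - a x :=
  integral_eq_of_hasDerivAt_off_countable a (deriv a) (Set.countable_singleton 0)
    ha.continuous.continuousOn (fun _ ht => ha.hasDerivAt ht.2)
    ha.integrable_deriv.intervalIntegrable

/-! ### The operator as a bounded integral operator on the window -/

theorem modConv_of_mem {a : ℝ → ℝ} {ξ x : ℝ} (hx : x ∈ Set.Icc (-ξ) ξ) (v : ℝ → ℝ) :
    modConv a ξ v x = ∫ y in Set.Icc (-ξ) ξ, a (x - y) * v y := by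
  unfold modConv cutoff
  rw [Set.indicator_of_mem hx, convolution_mul_swap, ← integral_indicator measurableSet_Icc]
  simp only [Set.indicator_mul_right]

theorem modConv_of_notMem {a : ℝ → ℝ} {ξ x : ℝ} (hx : x ∉ Set.Icc (-ξ) ξ) (v : ℝ → ℝ) :
    modConv a ξ v x = 0 :=
  Set.indicator_of_notMem hx _

theorem coeFn_modConvL2 {a : ℝ → ℝ} (ha : MemLp a 2 volume) (ξ : ℝ) (v : L2) :
    modConvL2 a ha ξ v =ᵐ[volume] modConv a ξ v :=
  MemLp.coeFn_toLp (memLp_modConv ha ξ (Lp.memLp v))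

theorem integrableOn_window (ξ : ℝ) (v : L2) : IntegrableOn v (Set.Icc (-ξ) ξ) volume :=
  ((Lp.memLp v).restrict _).integrable one_le_two

theorem IsKernel.integrableOn_mul {a : ℝ → ℝ} (ha : IsKernel a) {s : Set ℝ} {v : ℝ → ℝ}
    (hv : IntegrableOn v s volume) (x : ℝ) :
    IntegrableOn (fun y => a (x - y) * v y) s volume :=
  Integrable.bdd_mul hv (ha.continuous.comp (continuous_sub_left x)).aestronglyMeasurable
    (Filter.Eventually.of_forall fun y => ha.norm_le (x - y))

/-- The indicator function of `[-ξ, ξ]` as an element of `L²(ℝ)`. -/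
noncomputable def windowL2 (ξ : ℝ) : L2 :=
  indicatorConstLp 2 (measurableSet_Icc (a := -ξ) (b := ξ)) measure_Icc_lt_top.ne 1

theorem setIntegral_abs_le (ξ : ℝ) (v : L2) :
    ∫ y in Set.Icc (-ξ) ξ, |v y| ≤ ‖windowL2 ξ‖ * ‖v‖ := by
  have h : ∫ y in Set.Icc (-ξ) ξ, |v y| = ⟪windowL2 ξ, |v|⟫ := by
    rw [windowL2, L2.inner_indicatorConstLp_one]
    refine integral_congr_ae (ae_restrict_of_ae ?_)
    filter_upwards [Lp.coeFn_abs v] with y hy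
    exact hy.symm
  rw [h, ← norm_abs_eq_norm v]
  exact real_inner_le_norm _ _

theorem norm_le_mul_windowL2 {ξ C : ℝ} {v : L2}
    (h : ∀ᵐ x : ℝ, |v x| ≤ (Set.Icc (-ξ) ξ).indicator (fun _ => C) x) :
    ‖v‖ ≤ C * ‖windowL2 ξ‖ := by
  refine Lp.norm_le_mul_norm_of_ae_le_mul ?_
  filter_upwards [h, indicatorConstLp_coeFn (p := 2) (μ := (volume : Measure ℝ))
    (hs := measurableSet_Icc (a := -ξ) (b := ξ)) (hμs := measure_Icc_lt_top.ne) (c := (1 : ℝ))]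
    with x h1 h2
  rw [windowL2, h2]
  by_cases hx : x ∈ Set.Icc (-ξ) ξ
  · simpa [Set.indicator_of_mem hx] using h1
  · simpa [Set.indicator_of_notMem hx] using h1

theorem abs_setIntegral_mul_le {ξ C : ℝ} {k : ℝ → ℝ}
    (hk : ∀ y ∈ Set.Icc (-ξ) ξ, |k y| ≤ C) (v : L2) :
    |∫ y in Set.Icc (-ξ) ξ, k y * v y| ≤ C * (∫ y in Set.Icc (-ξ) ξ, |v y|) := by
  rw [← integral_const_mul, ← Real.norm_eq_abs]
  refine norm_integral_le_of_norm_le ((integrableOn_window ξ v).abs.const_mul C) ?_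
  refine (ae_restrict_iff' measurableSet_Icc).2 (Filter.Eventually.of_forall fun y hy => ?_)
  rw [norm_mul, Real.norm_eq_abs, Real.norm_eq_abs]
  exact mul_le_mul_of_nonneg_right (hk y hy) (abs_nonneg _)

theorem norm_modConvL2_le {a : ℝ → ℝ} (ha : IsKernel a) (ξ : ℝ) (v : L2) :
    ‖modConvL2 a ha.mem_coneU.1 ξ v‖ ≤ (a 0 * ‖windowL2 ξ‖ * ‖windowL2 ξ‖) * ‖v‖ := by
  have h : ‖modConvL2 a ha.mem_coneU.1 ξ v‖ ≤
      (a 0 * (∫ y in Set.Icc (-ξ) ξ, |v y|)) * ‖windowL2 ξ‖ := by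
    refine norm_le_mul_windowL2 ?_
    filter_upwards [coeFn_modConvL2 ha.mem_coneU.1 ξ v] with x hx
    rw [hx]
    by_cases hxI : x ∈ Set.Icc (-ξ) ξ
    · rw [modConv_of_mem hxI, Set.indicator_of_mem hxI]
      exact abs_setIntegral_mul_le (fun y _ => ha.norm_le (x - y)) v
    · simp [modConv_of_notMem hxI, Set.indicator_of_notMem hxI]
  calc _ ≤ _ := h
    _ ≤ (a 0 * (‖windowL2 ξ‖ * ‖v‖)) * ‖windowL2 ξ‖ := by
        gcongr
        · exact ha.nonneg 0
        · exact setIntegral_abs_le ξ v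
    _ = _ := by ring

/-- The operator `v ↦ χ_ξ · (a ∗ (χ_ξ · v))` as a continuous linear map on `L²(ℝ)`. -/
noncomputable def modConvCLM (a : ℝ → ℝ) (ha : IsKernel a) (ξ : ℝ) : L2 →L[ℝ] L2 :=
  (modConvL2 a ha.mem_coneU.1 ξ).mkContinuous _ (norm_modConvL2_le ha ξ)

theorem coeFn_modConvCLM {a : ℝ → ℝ} (ha : IsKernel a) (ξ : ℝ) (v : L2) :
    modConvCLM a ha ξ v =ᵐ[volume] modConv a ξ v :=
  coeFn_modConvL2 ha.mem_coneU.1 ξ v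

/-! ### Compactness by finite-rank approximation -/

theorem isCompactOperator_rankOne {E : Type*} [NormedAddCommGroup E] [InnerProductSpace ℝ E]
    (x y : E) : IsCompactOperator (InnerProductSpace.rankOne ℝ x y) := by
  have h : IsCompactOperator (innerSL ℝ y : E →L[ℝ] ℝ) :=
    isCompactOperator_of_locallyCompactSpace_dom _
  exact h.clm_comp (ContinuousLinearMap.toSpanSingleton ℝ x)

theorem isCompactOperator_sum {E ι : Type*} [NormedAddCommGroup E] [NormedSpace ℝ E]
    (s : Finset ι) (f : ι → E →L[ℝ] E) (hf : ∀ i ∈ s, IsCompactOperator (f i)) :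
    IsCompactOperator (∑ i ∈ s, f i : E →L[ℝ] E) := by
  have : (∑ i ∈ s, f i) ∈ compactOperator (RingHom.id ℝ) E E :=
    Submodule.sum_mem _ fun i hi => hf i hi
  exact this

/-- The part of `[-ξ, ξ]` that lies in the `k`-th cell of the grid of mesh `δ`. -/
def cell (ξ δ : ℝ) (k : ℤ) : Set ℝ := Set.Icc (-ξ) ξ ∩ {x | ⌊x / δ⌋ = k}

theorem measurableSet_cell (ξ δ : ℝ) (k : ℤ) : MeasurableSet (cell ξ δ k) :=
  measurableSet_Icc.inter
    ((measurable_id.div_const δ).floor (measurableSet_singleton k))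

theorem volume_cell_ne_top (ξ δ : ℝ) (k : ℤ) : volume (cell ξ δ k) ≠ ⊤ :=
  ((measure_mono Set.inter_subset_left).trans_lt measure_Icc_lt_top).ne

theorem IsKernel.memLp_cutoff_sub {a : ℝ → ℝ} (ha : IsKernel a) (ξ s : ℝ) :
    MemLp (cutoff ξ fun y => a (s - y)) 2 volume :=
  memLp_cutoff ξ (memLp_reflect ha.mem_coneU.1 s)

/-- The finite-rank operator obtained from `modConvCLM` by replacing the kernel `a (x - y)` by
`a (k δ - y)` for `x` in the `k`-th cell. -/
noncomputable def stepConv (a : ℝ → ℝ) (ha : IsKernel a) (ξ δ : ℝ) (N : ℕ) : L2 →L[ℝ] L2 :=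
  ∑ k ∈ Finset.Icc (-N : ℤ) N,
    InnerProductSpace.rankOne ℝ
      (indicatorConstLp 2 (measurableSet_cell ξ δ k) (volume_cell_ne_top ξ δ k) (1 : ℝ))
      ((ha.memLp_cutoff_sub ξ (k * δ)).toLp (cutoff ξ fun y => a (k * δ - y)))

theorem inner_cutoff_toLp {a : ℝ → ℝ} (ha : IsKernel a) (ξ s : ℝ) (v : L2) :
    ⟪(ha.memLp_cutoff_sub ξ s).toLp (cutoff ξ fun y => a (s - y)), v⟫ = ∫ y in Set.Icc (-ξ) ξ, a (s - y) * v y := by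
  rw [L2.inner_def, ← integral_indicator measurableSet_Icc]
  refine integral_congr_ae ?_
  filter_upwards [MemLp.coeFn_toLp (ha.memLp_cutoff_sub ξ s)] with y hy
  rw [hy, cutoff, Set.indicator_mul_left]
  simp [mul_comm]

theorem coeFn_stepConv {a : ℝ → ℝ} (ha : IsKernel a) (ξ δ : ℝ) (N : ℕ) (v : L2) :
    stepConv a ha ξ δ N v =ᵐ[volume] fun x => ∑ k ∈ Finset.Icc (-N : ℤ) N,
      (∫ y in Set.Icc (-ξ) ξ, a (k * δ - y) * v y) * (cell ξ δ k).indicator (fun _ => 1) x := by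
  have h1 : stepConv a ha ξ δ N v = ∑ k ∈ Finset.Icc (-N : ℤ) N,
      (∫ y in Set.Icc (-ξ) ξ, a (k * δ - y) * v y) •
        indicatorConstLp 2 (measurableSet_cell ξ δ k) (volume_cell_ne_top ξ δ k) (1 : ℝ) := by
    rw [stepConv, sum_apply]
    refine Finset.sum_congr rfl fun k _ => ?_
    rw [InnerProductSpace.rankOne_apply, inner_cutoff_toLp ha ξ (k * δ) v]
  rw [h1]
  have h2 : ∀ k : ℤ, ∀ᵐ x : ℝ, ((∫ y in Set.Icc (-ξ) ξ, a (k * δ - y) * v y) •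
        indicatorConstLp 2 (measurableSet_cell ξ δ k) (volume_cell_ne_top ξ δ k) (1 : ℝ) : L2) x =
      (∫ y in Set.Icc (-ξ) ξ, a (k * δ - y) * v y) * (cell ξ δ k).indicator (fun _ => 1) x := by
    intro k
    filter_upwards [Lp.coeFn_smul (∫ y in Set.Icc (-ξ) ξ, a (k * δ - y) * v y)
        (indicatorConstLp 2 (measurableSet_cell ξ δ k) (volume_cell_ne_top ξ δ k) (1 : ℝ)),
      indicatorConstLp_coeFn (p := 2) (hs := measurableSet_cell ξ δ k)
        (hμs := volume_cell_ne_top ξ δ k) (c := (1 : ℝ))] with x hx1 hx2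
    rw [hx1, Pi.smul_apply, hx2, smul_eq_mul]
  filter_upwards [Lp.coeFn_finsetSum (Finset.Icc (-N : ℤ) N) fun k =>
    (∫ y in Set.Icc (-ξ) ξ, a (k * δ - y) * v y) •
        indicatorConstLp 2 (measurableSet_cell ξ δ k) (volume_cell_ne_top ξ δ k) (1 : ℝ),
    ae_all_iff.2 h2] with x hx1 hx2
  rw [hx1, Finset.sum_apply]
  exact Finset.sum_congr rfl fun k _ => hx2 k

/-- Compact operators are closed in operator norm, and uniform continuity of `a` on a compact
interval makes `stepConv` approximate the operator on a fine grid. -/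
theorem isCompactOperator_modConvCLM {a : ℝ → ℝ} (ha : IsKernel a) (ξ : ℝ) :
    IsCompactOperator (modConvCLM a ha ξ) := by
  have hcl : IsClosed {f : L2 →L[ℝ] L2 | IsCompactOperator f} :=
    isClosed_setOfPred_isCompactOperator
  refine hcl.closure_subset (Metric.mem_closure_iff.2 fun ε hε => ?_)
  set κ := ‖windowL2 ξ‖ with hκ
  have hκ0 : 0 ≤ κ := norm_nonneg _
  -- A kernel error of at most `η` costs at most `η * κ * κ` in operator norm, which is below `ε`.
  set η := ε / (2 * (κ * κ + 1)) with hη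
  have hη0 : 0 < η := by positivity
  -- The interval contains `x - y` for `x`, `y` in the window, and the extra `1` leaves room for
  -- rounding `x` down to the grid of mesh `δ ≤ 1`.
  obtain ⟨δ₀, hδ₀, huc⟩ := Metric.uniformContinuousOn_iff.1
    ((isCompact_Icc (a := -(2 * |ξ| + 1)) (b := 2 * |ξ| + 1)).uniformContinuousOn_of_continuous
      ha.continuous.continuousOn) η hη0
  set δ := min (δ₀ / 2) 1 with hδ
  have hδ0 : 0 < δ := by positivity
  have hδ1 : δ ≤ 1 := min_le_right _ _
  have hδ2 : δ < δ₀ := (min_le_left _ _).trans_lt (by linarith)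
  -- The `+ 1` accounts for the floor, which can lie below `-|ξ| / δ` by less than one.
  obtain ⟨N, hN⟩ := exists_nat_ge (|ξ| / δ + 1)
  refine ⟨stepConv a ha ξ δ N,
    isCompactOperator_sum _ _ fun k _ => isCompactOperator_rankOne _ _, ?_⟩
  have hbound : ∀ v : L2, ‖(modConvCLM a ha ξ - stepConv a ha ξ δ N) v‖ ≤ η * κ * κ * ‖v‖ := by
    intro v
    have h : ‖(modConvCLM a ha ξ - stepConv a ha ξ δ N) v‖ ≤
        (η * (∫ y in Set.Icc (-ξ) ξ, |v y|)) * κ := by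
      refine norm_le_mul_windowL2 ?_
      rw [sub_apply]
      filter_upwards [Lp.coeFn_sub (modConvCLM a ha ξ v) (stepConv a ha ξ δ N v),
        coeFn_modConvCLM ha ξ v, coeFn_stepConv ha ξ δ N v] with x h1 h2 h3
      rw [h1, Pi.sub_apply, h2, h3]
      by_cases hx : x ∈ Set.Icc (-ξ) ξ
      · have hxξ : |x| ≤ |ξ| := (abs_le.2 ⟨hx.1, hx.2⟩).trans (le_abs_self ξ)
        have hfl1 : (⌊x / δ⌋ : ℝ) * δ ≤ x := by
          rw [← le_div_iff₀ hδ0]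
          exact Int.floor_le _
        have hfl2 : x < (⌊x / δ⌋ : ℝ) * δ + δ := by
          have := Int.lt_floor_add_one (x / δ)
          rw [div_lt_iff₀ hδ0] at this
          linarith
        have hmem : ⌊x / δ⌋ ∈ Finset.Icc (-N : ℤ) N := by
          have h4 : |x / δ| ≤ |ξ| / δ := by
            rw [abs_div, abs_of_pos hδ0]
            gcongr
          have h5 := abs_le.1 h4
          have h6 := Int.floor_le (x / δ)
          have h7 := Int.lt_floor_add_one (x / δ)
          rw [Finset.mem_Icc]
          constructor
          · have : (-(N : ℝ)) ≤ ⌊x / δ⌋ := by linarith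
            exact_mod_cast this
          · have : (⌊x / δ⌋ : ℝ) ≤ N := by linarith
            exact_mod_cast this
        rw [Finset.sum_eq_single_of_mem _ hmem fun k _ hk => by
          rw [Set.indicator_of_notMem (fun h => hk h.2.symm), mul_zero],
          Set.indicator_of_mem (show x ∈ cell ξ δ ⌊x / δ⌋ from ⟨hx, rfl⟩), mul_one,
          modConv_of_mem hx, Set.indicator_of_mem hx,
          ← integral_sub (ha.integrableOn_mul (integrableOn_window ξ v) _)
            (ha.integrableOn_mul (integrableOn_window ξ v) _)]
        simp only [← sub_mul]
        refine abs_setIntegral_mul_le (fun y hy => ?_) v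
        have hyξ : |y| ≤ |ξ| := (abs_le.2 ⟨hy.1, hy.2⟩).trans (le_abs_self ξ)
        have hx' := abs_le.1 hxξ
        have hy' := abs_le.1 hyξ
        refine (huc (x - y) ⟨by linarith, by linarith⟩ (⌊x / δ⌋ * δ - y)
          ⟨by linarith, by linarith⟩ ?_).le
        rw [Real.dist_eq, abs_lt]
        constructor <;> linarith
      · rw [modConv_of_notMem hx, Set.indicator_of_notMem hx, Finset.sum_eq_zero fun k _ => by
          rw [Set.indicator_of_notMem (fun h => hx h.1), mul_zero]]
        simp
    calc _ ≤ _ := h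
      _ ≤ (η * (κ * ‖v‖)) * κ := by
          gcongr
          exact setIntegral_abs_le ξ v
      _ = _ := by ring
  rw [dist_eq_norm]
  refine (ContinuousLinearMap.opNorm_le_bound _ (by positivity) hbound).trans_lt ?_
  rw [hη, mul_assoc, div_mul_eq_mul_div, div_lt_iff₀ (by positivity)]
  nlinarith [mul_nonneg hκ0 hκ0, mul_nonneg hε.le (mul_nonneg hκ0 hκ0)]

/-! ### Symmetry and restriction to odd functions -/

/-- Fubini together with evenness of `a`. The double integral converges absolutely because a bounded
kernel multiplies a tensor product of functions integrable on the window. -/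
theorem modConvCLM_isSymmetric {a : ℝ → ℝ} (ha : IsKernel a) (ξ : ℝ) :
    (modConvCLM a ha ξ : L2 →ₗ[ℝ] L2).IsSymmetric := by
  intro v w
  simp only [ContinuousLinearMap.coe_coe]
  set I := Set.Icc (-ξ) ξ with hI
  have key : ∀ f g : L2, ⟪modConvCLM a ha ξ f, g⟫ =
      ∫ x in I, ∫ y in I, a (x - y) * f y * g x := by
    intro f g
    rw [L2.inner_def, ← integral_indicator measurableSet_Icc]
    refine integral_congr_ae ?_
    filter_upwards [coeFn_modConvCLM ha ξ f] with x hx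
    rw [hx]
    by_cases hxI : x ∈ I
    · rw [modConv_of_mem hxI, Set.indicator_of_mem hxI, integral_mul_const]
      simp [mul_comm, hI]
    · rw [modConv_of_notMem hxI, Set.indicator_of_notMem hxI]
      simp
  rw [key, real_inner_comm, key, integral_integral_swap]
  · refine integral_congr_ae (Filter.Eventually.of_forall fun x => ?_)
    refine integral_congr_ae (Filter.Eventually.of_forall fun y => ?_)
    simp only
    rw [← neg_sub y x, ha.even]
    ring
  · have hprod : Integrable (fun p : ℝ × ℝ => w p.1 * v p.2)
        ((volume.restrict I).prod (volume.restrict I)) :=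
      (integrableOn_window ξ w).mul_prod (integrableOn_window ξ v)
    have h := Integrable.bdd_mul (f := fun p : ℝ × ℝ => a (p.1 - p.2)) (c := a 0) hprod
      (ha.continuous.comp (continuous_fst.sub continuous_snd)).aestronglyMeasurable
      (Filter.Eventually.of_forall fun p => ha.norm_le (p.1 - p.2))
    refine h.congr (Filter.Eventually.of_forall fun p => ?_)
    simp only [Function.uncurry]
    ring

/-- Oddness is the equality of two continuous maps, reflection and negation. Closedness provides the
completeness and the restricted compactness needed on `oddL2`. -/
theorem isClosed_oddL2 : IsClosed (oddL2 : Set L2) := by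
  have hm := Measure.measurePreserving_neg (volume : Measure ℝ)
  have h : (oddL2 : Set L2) = {v : L2 | Lp.compMeasurePreservingₗᵢ ℝ Neg.neg hm v = -v} := by
    ext v
    change (∀ᵐ x : ℝ, v (-x) = -v x) ↔ _
    rw [Set.mem_ofPred_eq, Lp.ext_iff]
    have h1 := Lp.coeFn_compMeasurePreserving v hm
    have h2 := Lp.coeFn_neg v
    constructor
    · intro hv
      filter_upwards [hv, h1, h2] with x hx hx1 hx2
      exact hx1.trans (hx.trans hx2.symm)
    · intro hv
      filter_upwards [hv, h1, h2] with x hx hx1 hx2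
      exact hx1.symm.trans (hx.trans hx2)
  rw [h]
  exact isClosed_eq (LinearIsometry.continuous _) continuous_neg

instance : CompleteSpace oddL2 := isClosed_oddL2.completeSpace_coe

theorem isCompactOperator_opA {a : ℝ → ℝ} (ha : IsKernel a) (ξ : ℝ) :
    IsCompactOperator (opA a ha ξ) :=
  IsCompactOperator.restrict (f := modConvL2 a ha.mem_coneU.1 ξ)
    (isCompactOperator_modConvCLM ha ξ) (modConvL2_mem_oddL2 ha ξ) isClosed_oddL2

theorem opA_isSymmetric {a : ℝ → ℝ} (ha : IsKernel a) (ξ : ℝ) : (opA a ha ξ).IsSymmetric :=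
  fun v w => modConvCLM_isSymmetric ha ξ v w

theorem coeFn_opA {a : ℝ → ℝ} (ha : IsKernel a) (ξ : ℝ) (v : oddL2) :
    (opA a ha ξ v : L2) =ᵐ[volume] modConv a ξ (v : L2) :=
  coeFn_modConvL2 ha.mem_coneU.1 ξ v

/-! ### The strictly positive kernel on the half-line -/

/-- On odd functions, `modConv` acts on the half-line with the kernel `a (x - y) - a (x + y)`. -/
theorem modConv_eq_halfline {a : ℝ → ℝ} (ha : IsKernel a) {ξ x : ℝ} (hξ : 0 < ξ)
    (hx : x ∈ Set.Icc (-ξ) ξ) {v : ℝ → ℝ} (hv : IntegrableOn v (Set.Icc (-ξ) ξ) volume)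
    (hodd : ∀ᵐ y : ℝ, v (-y) = -v y) :
    modConv a ξ v x = ∫ y in Set.Ioc 0 ξ, (a (x - y) - a (x + y)) * v y := by
  have hint := ha.integrableOn_mul hv x
  have hI : ∀ s t, s ∈ Set.Icc (-ξ) ξ → t ∈ Set.Icc (-ξ) ξ →
      IntervalIntegrable (fun y => a (x - y) * v y) volume s t := fun s t hs ht =>
    (hint.mono_set (Set.uIcc_subset_Icc hs ht)).intervalIntegrable
  have m0 : (0 : ℝ) ∈ Set.Icc (-ξ) ξ := ⟨by linarith, hξ.le⟩
  have m1 : -ξ ∈ Set.Icc (-ξ) ξ := ⟨le_rfl, by linarith⟩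
  have m2 : ξ ∈ Set.Icc (-ξ) ξ := ⟨by linarith, le_rfl⟩
  have hneg : ∫ y in (-ξ)..0, a (x - y) * v y = ∫ y in (0 : ℝ)..ξ, a (x + y) * v (-y) := by
    have h := intervalIntegral.integral_comp_neg (a := 0) (b := ξ) (fun y => a (x - y) * v y)
    simpa using h.symm
  have hint2 : IntervalIntegrable (fun y => a (x + y) * v (-y)) volume 0 ξ := by
    have h := (hI (-ξ) 0 m1 m0).comp_sub_left 0
    simpa using h.symm
  rw [modConv_of_mem hx, integral_Icc_eq_integral_Ioc,
    ← intervalIntegral.integral_of_le (by linarith : -ξ ≤ ξ),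
    ← intervalIntegral.integral_add_adjacent_intervals (hI _ _ m1 m0) (hI _ _ m0 m2), hneg,
    ← intervalIntegral.integral_add hint2 (hI _ _ m0 m2),
    intervalIntegral.integral_of_le hξ.le]
  refine integral_congr_ae (ae_restrict_of_ae ?_)
  filter_upwards [hodd] with y hy
  rw [hy]
  ring

theorem IsKernel.halfline_pos {a : ℝ → ℝ} (ha : IsKernel a) {x y : ℝ} (hx : 0 < x) (hy : 0 < y) :
    0 < a (x - y) - a (x + y) := by
  refine sub_pos.2 (ha.lt_of_abs_lt ?_)
  rw [abs_of_pos (add_pos hx hy), abs_lt]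
  constructor <;> linarith

theorem IsKernel.integrableOn_halfline {a : ℝ → ℝ} (ha : IsKernel a) {ξ : ℝ} {v : ℝ → ℝ}
    (hξ : 0 < ξ) (hv : IntegrableOn v (Set.Icc (-ξ) ξ) volume) (x : ℝ) :
    IntegrableOn (fun y => (a (x - y) - a (x + y)) * v y) (Set.Ioc 0 ξ) volume := by
  have hv' : IntegrableOn v (Set.Ioc 0 ξ) volume :=
    hv.mono_set fun y hy => ⟨by linarith [hy.1], hy.2⟩
  refine Integrable.bdd_mul (c := a 0 + a 0) hv' ?_ (Filter.Eventually.of_forall fun y => ?_)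
  · exact ((ha.continuous.comp (continuous_sub_left x)).sub
      (ha.continuous.comp (continuous_const_add x))).aestronglyMeasurable
  · exact (norm_sub_le _ _).trans (add_le_add (ha.norm_le _) (ha.norm_le _))

/-- The operator is positivity improving: the integrand has one sign, and a vanishing integral would
force `v` to vanish almost everywhere on `(0, ξ]`, as the folded kernel has no zeros there. -/
theorem modConv_neg {a : ℝ → ℝ} (ha : IsKernel a) {ξ x : ℝ} (hx : x ∈ Set.Ioc 0 ξ) {v : ℝ → ℝ}
    (hv : IntegrableOn v (Set.Icc (-ξ) ξ) volume) (hodd : ∀ᵐ y : ℝ, v (-y) = -v y)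
    (hle : ∀ᵐ y : ℝ, 0 < y → v y ≤ 0) (hne : ¬ ∀ᵐ y : ℝ, y ∈ Set.Ioc 0 ξ → v y = 0) :
    modConv a ξ v x < 0 := by
  have hξ : 0 < ξ := hx.1.trans_le hx.2
  rw [modConv_eq_halfline ha hξ ⟨by linarith [hx.1], hx.2⟩ hv hodd]
  have hnn : 0 ≤ᵐ[volume.restrict (Set.Ioc 0 ξ)]
      fun y => -((a (x - y) - a (x + y)) * v y) := by
    refine (ae_restrict_iff' measurableSet_Ioc).2 ?_
    filter_upwards [hle] with y hy hyI
    exact neg_nonneg.2 (mul_nonpos_of_nonneg_of_nonpos (ha.halfline_pos hx.1 hyI.1).le (hy hyI.1))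
  have hint := (ha.integrableOn_halfline hξ hv x).neg
  have h0 : 0 ≤ ∫ y in Set.Ioc 0 ξ, -((a (x - y) - a (x + y)) * v y) :=
    integral_nonneg_of_ae hnn
  have h1 : (∫ y in Set.Ioc 0 ξ, -((a (x - y) - a (x + y)) * v y)) ≠ 0 := by
    intro h
    refine hne ?_
    have h2 := (ae_restrict_iff' measurableSet_Ioc).1 ((integral_eq_zero_iff_of_nonneg_ae hnn hint).1 h)
    filter_upwards [h2] with y hy hyI
    have := hy hyI
    simp only [Pi.zero_apply, neg_eq_zero, mul_eq_zero] at this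
    exact this.resolve_left (ha.halfline_pos hx.1 hyI.1).ne'
  rw [integral_neg] at h0 h1
  exact lt_of_le_of_ne (by linarith) (fun h => h1 (by rw [h, neg_zero]))

/-! ### Passing to `-sign(x) |v|` and the quadratic form -/

theorem memLp_negAbs (v : L2) :
    MemLp (fun x => (if 0 < x then (-1 : ℝ) else 1) * |v x|) 2 volume := by
  refine (Lp.memLp v).mono ?_ (Filter.Eventually.of_forall fun x => ?_)
  · exact ((Measurable.ite measurableSet_Ioi measurable_const
      measurable_const).aestronglyMeasurable).mul (Lp.aestronglyMeasurable v).norm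
  · split_ifs <;> simp

/-- The function `-sign(x) |v(x)|`. -/
noncomputable def negAbs (v : L2) : L2 := (memLp_negAbs v).toLp _

theorem coeFn_negAbs (v : L2) :
    negAbs v =ᵐ[volume] fun x => (if 0 < x then (-1 : ℝ) else 1) * |v x| :=
  MemLp.coeFn_toLp _

theorem negAbs_of_pos (v : L2) : ∀ᵐ x : ℝ, 0 < x → negAbs v x = -|v x| := by
  filter_upwards [coeFn_negAbs v] with x hx h
  rw [hx, if_pos h, neg_one_mul]

theorem norm_negAbs (v : L2) : ‖negAbs v‖ = ‖v‖ := by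
  have h : ∀ᵐ x : ℝ, ‖negAbs v x‖ = ‖v x‖ := by
    filter_upwards [coeFn_negAbs v] with x hx
    rw [hx]
    split_ifs <;> simp
  rw [Lp.norm_def, Lp.norm_def, eLpNorm_congr_norm_ae h]

theorem ae_ne_zero : ∀ᵐ x : ℝ, x ≠ 0 := by
  simp [ae_iff, measure_singleton]

theorem negAbs_mem_oddL2 {v : L2} (hv : ∀ᵐ x : ℝ, |v (-x)| = |v x|) : negAbs v ∈ oddL2 := by
  change ∀ᵐ x : ℝ, negAbs v (-x) = -negAbs v x
  filter_upwards [coeFn_negAbs v, ae_neg (coeFn_negAbs v), hv, ae_ne_zero] with x h1 h2 h3 h4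
  rw [h1, h2, h3]
  rcases lt_or_gt_of_ne h4 with h | h
  · rw [if_pos (by linarith), if_neg (by linarith)]
    ring
  · rw [if_neg (by linarith), if_pos h]
    ring

/-- A.e. statements on the half-line that are invariant under reflection hold a.e. -/
theorem ae_of_ae_pos {p : ℝ → Prop} (hp : ∀ᵐ x : ℝ, 0 < x → p x)
    (hneg : ∀ᵐ x : ℝ, p (-x) → p x) : ∀ᵐ x : ℝ, p x := by
  filter_upwards [hp, ae_neg hp, hneg, ae_ne_zero] with x h1 h2 h3 h4
  rcases lt_or_gt_of_ne h4 with h | h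
  · exact h3 (h2 (by linarith))
  · exact h1 h

theorem inner_opA_eq {a : ℝ → ℝ} (ha : IsKernel a) (ξ : ℝ) (v : oddL2) :
    ⟪opA a ha ξ v, v⟫ = ∫ x, modConv a ξ (v : L2) x * (v : L2) x := by
  rw [Submodule.coe_inner, L2.inner_def]
  refine integral_congr_ae ?_
  filter_upwards [coeFn_opA ha ξ v] with x hx
  rw [hx]
  simp [mul_comm]

theorem integrable_modConv_mul {a : ℝ → ℝ} (ha : IsKernel a) (ξ : ℝ) (v : L2) :
    Integrable (fun x => modConv a ξ v x * v x) volume :=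
  MemLp.integrable_mul (memLp_modConv ha.mem_coneU.1 ξ (Lp.memLp v)) (Lp.memLp v)

theorem modConv_mul_neg {a : ℝ → ℝ} (ha : IsKernel a) (ξ : ℝ) (v : oddL2) :
    ∀ᵐ x : ℝ, modConv a ξ (v : L2) (-x) * (v : L2) (-x) = modConv a ξ (v : L2) x * (v : L2) x := by
  filter_upwards [(v.2 : ∀ᵐ x : ℝ, (v : L2) (-x) = -(v : L2) x)] with x hx
  rw [modConv_odd ha.mem_coneU.2.1 ξ v.2, hx]
  ring

theorem ae_abs_even (v : oddL2) : ∀ᵐ x : ℝ, |(v : L2) (-x)| = |(v : L2) x| := by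
  filter_upwards [(v.2 : ∀ᵐ x : ℝ, (v : L2) (-x) = -(v : L2) x)] with x hx
  rw [hx, abs_neg]

/-- `negAbs` on odd functions. -/
noncomputable def negAbsOdd (v : oddL2) : oddL2 := ⟨negAbs v, negAbs_mem_oddL2 (ae_abs_even v)⟩

/-- The triangle inequality under a positive kernel, applied pointwise for `x > 0`; the integrands
are even, so the half-line suffices. -/
theorem inner_opA_le_negAbsOdd {a : ℝ → ℝ} (ha : IsKernel a) {ξ : ℝ} (hξ : 0 < ξ) (v : oddL2) :
    ⟪opA a ha ξ v, v⟫ ≤ ⟪opA a ha ξ (negAbsOdd v), negAbsOdd v⟫ := by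
  rw [inner_opA_eq, inner_opA_eq]
  refine integral_mono_ae (integrable_modConv_mul ha ξ _) (integrable_modConv_mul ha ξ _) ?_
  refine ae_of_ae_pos ?_ ?_
  · filter_upwards [negAbs_of_pos v] with x hw hx
    change _ ≤ modConv a ξ (negAbs v) x * negAbs v x
    rw [hw hx]
    by_cases hxI : x ∈ Set.Icc (-ξ) ξ
    · have hv1 := integrableOn_window ξ (v : L2)
      have hw1 := integrableOn_window ξ (negAbs v)
      have hB : modConv a ξ (negAbs v) x =
          -∫ y in Set.Ioc 0 ξ, (a (x - y) - a (x + y)) * |(v : L2) y| := by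
        rw [modConv_eq_halfline ha hξ hxI hw1 (negAbsOdd v).2, ← integral_neg]
        refine integral_congr_ae ((ae_restrict_iff' measurableSet_Ioc).2 ?_)
        filter_upwards [negAbs_of_pos v] with y hy hyI
        rw [hy hyI.1]
        ring
      have hA : |modConv a ξ (v : L2) x| ≤
          ∫ y in Set.Ioc 0 ξ, (a (x - y) - a (x + y)) * |(v : L2) y| := by
        rw [modConv_eq_halfline ha hξ hxI hv1 v.2, ← Real.norm_eq_abs]
        refine norm_integral_le_of_norm_le (ha.integrableOn_halfline hξ hv1.abs x) ?_
        refine (ae_restrict_iff' measurableSet_Ioc).2 (Filter.Eventually.of_forall fun y hy => ?_)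
        rw [norm_mul, Real.norm_of_nonneg (ha.halfline_pos hx hy.1).le, Real.norm_eq_abs]
      rw [hB, neg_mul_neg]
      refine (le_abs_self _).trans ?_
      rw [abs_mul]
      gcongr
    · rw [modConv_of_notMem hxI, modConv_of_notMem hxI]
      simp
  · filter_upwards [modConv_mul_neg ha ξ v, modConv_mul_neg ha ξ (negAbsOdd v)] with x h1 h2 h3
    rwa [h1, h2] at h3

/-- The test function is `-sign(x)` cut off to the window: the operator keeps it negative on `(0,
ξ]`, so the integrand of the form is positive there. -/
theorem exists_inner_opA_pos {a : ℝ → ℝ} (ha : IsKernel a) {ξ : ℝ} (hξ : 0 < ξ) :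
    ∃ u : oddL2, 0 < ⟪opA a ha ξ u, u⟫ := by
  have hw : windowL2 ξ =ᵐ[volume] (Set.Icc (-ξ) ξ).indicator fun _ => (1 : ℝ) :=
    indicatorConstLp_coeFn
  have heven : ∀ᵐ x : ℝ, |windowL2 ξ (-x)| = |windowL2 ξ x| := by
    filter_upwards [hw, ae_neg hw] with x h1 h2
    have hiff : -x ∈ Set.Icc (-ξ) ξ ↔ x ∈ Set.Icc (-ξ) ξ := by
      simp only [Set.mem_Icc]
      constructor <;> rintro ⟨h1, h2⟩ <;> constructor <;> linarith
    rw [h1, h2]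
    by_cases hx : x ∈ Set.Icc (-ξ) ξ
    · rw [Set.indicator_of_mem hx, Set.indicator_of_mem (hiff.2 hx)]
    · rw [Set.indicator_of_notMem hx, Set.indicator_of_notMem (mt hiff.1 hx)]
  set u : oddL2 := ⟨negAbs (windowL2 ξ), negAbs_mem_oddL2 heven⟩ with hu
  have hpos : ∀ᵐ x : ℝ, x ∈ Set.Ioc 0 ξ → (u : L2) x = -1 := by
    filter_upwards [negAbs_of_pos (windowL2 ξ), hw] with x h1 h2 hx
    change negAbs (windowL2 ξ) x = -1
    rw [h1 hx.1, h2, Set.indicator_of_mem (show x ∈ Set.Icc (-ξ) ξ from ⟨by linarith [hx.1], hx.2⟩)]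
    simp
  have hvol : ¬ ∀ᵐ x : ℝ, x ∉ Set.Ioc 0 ξ := by
    rw [← measure_eq_zero_iff_ae_notMem]
    simp [hξ]
  have hmod : ∀ x ∈ Set.Ioc 0 ξ, modConv a ξ (u : L2) x < 0 := fun x hx => by
    refine modConv_neg ha hx (integrableOn_window ξ _) u.2 ?_ fun h => hvol ?_
    · filter_upwards [negAbs_of_pos (windowL2 ξ)] with y hy hy0
      exact (hy hy0).trans_le (neg_nonpos.2 (abs_nonneg _))
    · filter_upwards [h, hpos] with y h1 h2 hy
      linarith [h1 hy, h2 hy]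
  have hnn : ∀ᵐ x : ℝ, 0 ≤ modConv a ξ (u : L2) x * (u : L2) x := by
    refine ae_of_ae_pos ?_ ?_
    · filter_upwards [hpos] with x hx h0
      by_cases hxξ : x ≤ ξ
      · rw [hx ⟨h0, hxξ⟩]
        linarith [hmod x ⟨h0, hxξ⟩]
      · rw [modConv_of_notMem fun h => hxξ h.2, zero_mul]
    · filter_upwards [modConv_mul_neg ha ξ u] with x h1 h2
      rwa [h1] at h2
  refine ⟨u, ?_⟩
  rw [inner_opA_eq]
  refine lt_of_le_of_ne (integral_nonneg_of_ae hnn) fun h => hvol ?_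
  have h1 := (integral_eq_zero_iff_of_nonneg_ae hnn (integrable_modConv_mul ha ξ _)).1 h.symm
  filter_upwards [h1, hpos] with x h2 h3 hx
  have h4 := hmod x hx
  rw [h3 hx] at h2
  simp only [Pi.zero_apply] at h2
  linarith

/-! ### Eigenfunctions in the cone: strict sign -/

/-- The right-hand side is defined at every point, which gives an eigenfunction a canonical
representative supported in the window. -/
theorem coeFn_eigenvector {a : ℝ → ℝ} (ha : IsKernel a) {ξ lam : ℝ} (hlam : 0 < lam)
    {v : oddL2} (hv : opA a ha ξ v = lam • v) :
    (v : L2) =ᵐ[volume] fun x => lam⁻¹ * modConv a ξ (v : L2) x := by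
  have h := coeFn_opA ha ξ v
  rw [hv] at h
  filter_upwards [h, Lp.coeFn_smul lam (v : L2)] with x h1 h2
  rw [← h1, Submodule.coe_smul, h2, Pi.smul_apply, smul_eq_mul, inv_mul_cancel_left₀ hlam.ne']

/-- An eigenfunction that vanishes on the half-line vanishes. -/
theorem eq_zero_of_ae_halfline {a : ℝ → ℝ} (ha : IsKernel a) {ξ lam : ℝ} (hlam : 0 < lam)
    {v : oddL2} (hv : opA a ha ξ v = lam • v)
    (h0 : ∀ᵐ x : ℝ, x ∈ Set.Ioc 0 ξ → (v : L2) x = 0) : v = 0 := by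
  rw [← Subtype.coe_inj, Submodule.coe_zero, Lp.eq_zero_iff_ae_eq_zero]
  refine ae_of_ae_pos ?_ ?_
  · filter_upwards [h0, coeFn_eigenvector ha hlam hv] with x h1 h2 hx
    by_cases hxξ : x ≤ ξ
    · exact h1 ⟨hx, hxξ⟩
    · rw [h2, modConv_of_notMem fun h => hxξ h.2, mul_zero]
      rfl
  · filter_upwards [(v.2 : ∀ᵐ x : ℝ, (v : L2) (-x) = -(v : L2) x)] with x h1 h2
    rw [h1] at h2
    exact neg_eq_zero.1 h2

/-- An eigenfunction in the cone is strictly negative on `(0, ξ]`. -/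
theorem modConv_eigenvector_neg {a : ℝ → ℝ} (ha : IsKernel a) {ξ lam : ℝ} (hlam : 0 < lam)
    {v : oddL2} (hv : opA a ha ξ v = lam • v) (hv0 : v ≠ 0)
    (hle : ∀ᵐ x : ℝ, 0 < x → (v : L2) x ≤ 0) {x : ℝ} (hx : x ∈ Set.Ioc 0 ξ) :
    modConv a ξ (v : L2) x < 0 :=
  modConv_neg ha hx (integrableOn_window ξ _) v.2 hle fun h =>
    hv0 (eq_zero_of_ae_halfline ha hlam hv h)

theorem eigenvector_ae_neg {a : ℝ → ℝ} (ha : IsKernel a) {ξ lam : ℝ} (hlam : 0 < lam)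
    {v : oddL2} (hv : opA a ha ξ v = lam • v) (hv0 : v ≠ 0)
    (hle : ∀ᵐ x : ℝ, 0 < x → (v : L2) x ≤ 0) :
    ∀ᵐ x : ℝ, x ∈ Set.Ioc 0 ξ → (v : L2) x < 0 := by
  filter_upwards [coeFn_eigenvector ha hlam hv] with x h1 hx
  rw [h1]
  exact mul_neg_of_pos_of_neg (inv_pos.2 hlam) (modConv_eigenvector_neg ha hlam hv hv0 hle hx)

/-! ### Regularity of eigenfunctions and the slope at the origin -/

/-- The convolution of an integrable function with a bounded function that is continuous off a
countable set is continuous. -/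
theorem continuous_convolution_of_countable {b g : ℝ → ℝ} (hb : Integrable b volume)
    (hgm : AEStronglyMeasurable g volume) {C : ℝ} (hgC : ∀ y, ‖g y‖ ≤ C) {S : Set ℝ}
    (hS : S.Countable) (hgS : ∀ y, y ∉ S → ContinuousAt g y) :
    Continuous fun x => ∫ y, b (x - y) * g y := by
  have hswap : (fun x => ∫ y, b (x - y) * g y) = fun x => ∫ t, b t * g (x - t) := by
    ext x
    rw [← integral_sub_left_eq_self _ volume x]
    simp
  -- After the substitution the variable `x` sits in `g`, so no continuity of `b` is needed; the
  -- exceptional `t` form a countable, hence null, set.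
  rw [hswap, continuous_iff_continuousAt]
  intro x₀
  refine continuousAt_of_dominated (bound := fun t => ‖b t‖ * C) ?_ ?_ (hb.norm.mul_const C) ?_
  · exact Filter.Eventually.of_forall fun x => hb.aestronglyMeasurable.mul
      (hgm.comp_measurePreserving (Measure.measurePreserving_sub_left volume x))
  · refine Filter.Eventually.of_forall fun x => Filter.Eventually.of_forall fun t => ?_
    rw [norm_mul]
    exact mul_le_mul_of_nonneg_left (hgC _) (norm_nonneg _)
  · have hc : ((fun t => x₀ - t) ⁻¹' S).Countable :=
      hS.preimage (sub_right_injective (b := x₀))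
    filter_upwards [hc.ae_notMem volume] with t ht
    exact continuousAt_const.mul
      (ContinuousAt.comp (f := fun x => x - t) (hgS _ ht) (continuous_sub_right t).continuousAt)

/-- The derivative of `a` is only known to be integrable, so difference quotients are not dominated
directly. Instead Fubini exhibits the convolution as a primitive of the continuous function in `hG`.
-/
theorem hasDerivAt_convolution {a g : ℝ → ℝ} (ha : IsKernel a) (hg : Integrable g volume)
    (hG : Continuous fun x => ∫ y, deriv a (x - y) * g y) (x : ℝ) :
    HasDerivAt (fun x => ∫ y, a (x - y) * g y) (∫ y, deriv a (x - y) * g y) x := by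
  have hint : ∀ x, Integrable (fun y => a (x - y) * g y) volume := fun x => by
    simpa using ha.integrableOn_mul (s := Set.univ) (by simpa using hg) x
  have hF : ∀ x, ∫ y, a (x - y) * g y =
      (∫ y, a (0 - y) * g y) + ∫ s in (0 : ℝ)..x, ∫ y, deriv a (s - y) * g y := by
    intro x
    have hprod : Integrable (Function.uncurry fun s y => deriv a (s - y) * g y)
        ((volume.restrict (Set.uIoc 0 x)).prod volume) := by
      have h : Integrable (fun p : ℝ × ℝ => g p.2 * deriv a (p.1 - p.2))
          ((volume : Measure ℝ).prod volume) :=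
        hg.convolution_integrand (ContinuousLinearMap.mul ℝ ℝ) ha.integrable_deriv
      have hm : (volume.restrict (Set.uIoc 0 x)).prod (volume : Measure ℝ) =
          ((volume : Measure ℝ).prod volume).restrict (Set.uIoc 0 x ×ˢ Set.univ) := by
        rw [← Measure.prod_restrict, Measure.restrict_univ]
      rw [hm]
      refine h.restrict.congr (Filter.Eventually.of_forall fun p => ?_)
      simp only [Function.uncurry]
      ring
    rw [intervalIntegral_integral_swap hprod, ← sub_eq_iff_eq_add', ← integral_sub (hint x) (hint 0)]
    refine integral_congr_ae (Filter.Eventually.of_forall fun y => ?_)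
    simp only
    rw [intervalIntegral.integral_mul_const,
      intervalIntegral.integral_comp_sub_right (fun s => deriv a s) y, ha.integral_deriv]
    ring
  have hFeq : (fun x => ∫ y, a (x - y) * g y) = fun x =>
      (∫ y, a (0 - y) * g y) + ∫ s in (0 : ℝ)..x, ∫ y, deriv a (s - y) * g y := funext hF
  rw [hFeq]
  exact (hG.integral_hasStrictDerivAt 0 x).hasDerivAt.const_add _

theorem contDiff_convolution {a g : ℝ → ℝ} (ha : IsKernel a) (hg : Integrable g volume)
    (hG : Continuous fun x => ∫ y, deriv a (x - y) * g y) :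
    ContDiff ℝ 1 fun x => ∫ y, a (x - y) * g y := by
  have hd := hasDerivAt_convolution ha hg hG
  rw [contDiff_one_iff_deriv]
  refine ⟨fun x => (hd x).differentiableAt, ?_⟩
  rwa [show deriv (fun x => ∫ y, a (x - y) * g y) = _ from funext fun x => (hd x).deriv]

theorem continuous_setIntegral_sub_mul {a : ℝ → ℝ} (ha : IsKernel a) {s : Set ℝ} {v : ℝ → ℝ}
    (hv : IntegrableOn v s volume) : Continuous fun x => ∫ y in s, a (x - y) * v y := by
  refine continuous_of_dominated (bound := fun y => a 0 * ‖v y‖)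
    (fun x => (ha.integrableOn_mul hv x).aestronglyMeasurable) (fun x => ?_)
    (hv.norm.const_mul _) ?_
  · refine Filter.Eventually.of_forall fun y => ?_
    rw [norm_mul]
    exact mul_le_mul_of_nonneg_right (ha.norm_le _) (norm_nonneg _)
  · exact Filter.Eventually.of_forall fun y =>
      (ha.continuous.comp (continuous_sub_right y)).mul continuous_const

/-- A bootstrap: the eigenvalue equation makes the representative continuous up to jumps at the
endpoints, and a second use makes it $C^1$ on the window. Its slope at the origin is
$-\lambda^{-1}\int a'f$, where $a'$ and $f$ are both odd and negative on $(0,\xi]$. -/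
theorem eigenvector_mem_coneNtilde {a : ℝ → ℝ} (ha : IsKernel a) {ξ lam : ℝ} (hξ : 0 < ξ)
    (hlam : 0 < lam) {v : oddL2} (hv : opA a ha ξ v = lam • v) (hv0 : v ≠ 0)
    (hle : ∀ᵐ x : ℝ, 0 < x → (v : L2) x ≤ 0) : (v : L2) ∈ coneNtilde ξ := by
  set I := Set.Icc (-ξ) ξ with hI
  set f : ℝ → ℝ := fun x => lam⁻¹ * modConv a ξ (v : L2) x with hf
  have hvf : (v : L2) =ᵐ[volume] f := coeFn_eigenvector ha hlam hv
  have hfoff : ∀ x, x ∉ I → f x = 0 := fun x hx => by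
    simp only [hf, modConv_of_notMem hx, mul_zero]
  have hfodd : ∀ x, f (-x) = -f x := fun x => by
    simp only [hf, modConv_odd ha.mem_coneU.2.1 ξ v.2, mul_neg]
  have hfneg : ∀ x, 0 < x → x ≤ ξ → f x < 0 := fun x hx hxξ =>
    mul_neg_of_pos_of_neg (inv_pos.2 hlam)
      (modConv_eigenvector_neg ha hlam hv hv0 hle ⟨hx, hxξ⟩)
  set h : ℝ → ℝ := fun x => lam⁻¹ * ∫ y in I, a (x - y) * (v : L2) y with hh
  have hhc : Continuous h :=
    continuous_const.mul (continuous_setIntegral_sub_mul ha (integrableOn_window ξ _))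
  have hfh : f = I.indicator h := by
    ext x
    by_cases hx : x ∈ I
    · rw [Set.indicator_of_mem hx, hf, hh]
      simp only [modConv_of_mem hx, hI]
    · rw [Set.indicator_of_notMem hx, hfoff x hx]
  have hfint : Integrable f volume := by
    rw [hfh]
    exact hhc.integrableOn_Icc.integrable_indicator measurableSet_Icc
  obtain ⟨C, hC⟩ := isCompact_Icc.exists_bound_of_continuousOn (hhc.continuousOn (s := I))
  have hC0 : 0 ≤ C := (norm_nonneg _).trans (hC 0 ⟨by linarith, hξ.le⟩)
  have hfC : ∀ y, ‖f y‖ ≤ C := fun y => by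
    by_cases hy : y ∈ I
    · rw [hfh, Set.indicator_of_mem hy]
      exact hC y hy
    · rw [hfoff y hy, norm_zero]
      exact hC0
  -- The cutoff can create jumps at `±ξ`; this is why the continuity lemma tolerates a countable
  -- exceptional set.
  have hfcont : ∀ y, y ∉ ({-ξ, ξ} : Set ℝ) → ContinuousAt f y := fun y hy => by
    by_cases hyI : y ∈ I
    · have h1 : -ξ < y := lt_of_le_of_ne hyI.1 fun h => hy (Or.inl h.symm)
      have h2 : y < ξ := lt_of_le_of_ne hyI.2 fun h => hy (Or.inr h)
      refine hhc.continuousAt.congr ?_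
      filter_upwards [Icc_mem_nhds h1 h2] with z hz
      rw [hfh, Set.indicator_of_mem hz]
    · refine (continuousAt_const (y := (0 : ℝ))).congr ?_
      filter_upwards [isClosed_Icc.isOpen_compl.mem_nhds hyI] with z hz
      exact (hfoff z hz).symm
  have hG := continuous_convolution_of_countable ha.integrable_deriv hfint.aestronglyMeasurable hfC
    (Set.toFinite ({-ξ, ξ} : Set ℝ)).countable hfcont
  have hfF : ∀ x ∈ I, f x = lam⁻¹ * ∫ y, a (x - y) * f y := fun x hx => by
    change lam⁻¹ * modConv a ξ (v : L2) x = _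
    rw [modConv_congr a ξ hvf, modConv_of_mem hx, setIntegral_eq_integral_of_forall_compl_eq_zero]
    intro y hy
    rw [hfoff y hy, mul_zero]
  have hd0 : HasDerivAt f (lam⁻¹ * ∫ y, deriv a (0 - y) * f y) 0 := by
    refine ((hasDerivAt_convolution ha hfint hG 0).const_mul lam⁻¹).congr_of_eventuallyEq ?_
    filter_upwards [Icc_mem_nhds (show -ξ < 0 by linarith) hξ] with x hx
    exact hfF x hx
  have hf0 : f 0 = 0 := by
    have := hfodd 0
    rw [neg_zero] at this
    linarith
  have hder : deriv f 0 < 0 := by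
    rw [hd0.deriv]
    refine mul_neg_of_pos_of_neg (inv_pos.2 hlam) ?_
    have hpos : ∀ y, y ∈ Set.Ioc 0 ξ → 0 < deriv a y * f y := fun y hy =>
      mul_pos_of_neg_of_neg (ha.deriv_neg y hy.1) (hfneg y hy.1 hy.2)
    have hnn' : ∀ y, 0 ≤ y → 0 ≤ deriv a y * f y := fun y hy => by
      rcases hy.eq_or_lt with rfl | hy
      · rw [hf0, mul_zero]
      · by_cases hyξ : y ≤ ξ
        · exact (hpos y ⟨hy, hyξ⟩).le
        · rw [hfoff y fun h => hyξ h.2, mul_zero]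
    have hnn : 0 ≤ fun y => deriv a y * f y := fun y => by
      rcases le_total 0 y with hy | hy
      · exact hnn' y hy
      · have h1 := hnn' (-y) (by linarith)
        rwa [ha.deriv_odd, hfodd, neg_mul_neg] at h1
    have hint : Integrable (fun y => deriv a y * f y) volume :=
      ha.integrable_deriv.mul_bdd hfint.aestronglyMeasurable (Filter.Eventually.of_forall hfC)
    have hp : 0 < ∫ y, deriv a y * f y := by
      rw [integral_pos_iff_support_of_nonneg hnn hint]
      refine lt_of_lt_of_le ?_ (measure_mono (show Set.Ioc 0 ξ ⊆ _ from fun y hy => (hpos y hy).ne'))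
      simp [hξ]
    have heq : ∫ y, deriv a (0 - y) * f y = -∫ y, deriv a y * f y := by
      rw [← integral_neg]
      refine integral_congr_ae (Filter.Eventually.of_forall fun y => ?_)
      simp only [zero_sub, ha.deriv_odd, neg_mul]
    rw [heq]
    linarith
  refine ⟨⟨?_, hle⟩, f, hvf, hfodd, ?_, hder, hfneg, fun x hx => hfoff x fun h => ?_⟩
  · filter_upwards [(v.2 : ∀ᵐ x : ℝ, (v : L2) (-x) = -(v : L2) x)] with x hx
    rw [hx, neg_neg]
  · exact (contDiff_const.mul (contDiff_convolution ha hfint hG)).contDiffOn.congr hfF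
  · linarith [h.2]

/-! ### Simplicity of the largest eigenvalue -/

theorem not_ae_notMem_Ioc {ξ : ℝ} (hξ : 0 < ξ) : ¬ ∀ᵐ x : ℝ, x ∉ Set.Ioc 0 ξ := by
  rw [← measure_eq_zero_iff_ae_notMem]
  simp [hξ]

/-- The eigenvalue equation for `u` serves only to make the product vanish outside the window, where
nothing is assumed about `v`. -/
theorem inner_eigenvectors_pos {a : ℝ → ℝ} (ha : IsKernel a) {ξ lam : ℝ} (hξ : 0 < ξ)
    (hlam : 0 < lam) {u v : oddL2} (hu : opA a ha ξ u = lam • u)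
    (hun : ∀ᵐ x : ℝ, x ∈ Set.Ioc 0 ξ → (u : L2) x < 0)
    (hvn : ∀ᵐ x : ℝ, x ∈ Set.Ioc 0 ξ → (v : L2) x < 0) : 0 < ⟪u, v⟫ := by
  have hint : Integrable (fun x => (u : L2) x * (v : L2) x) volume :=
    MemLp.integrable_mul (Lp.memLp _) (Lp.memLp _)
  have heq : ⟪u, v⟫ = ∫ x, (u : L2) x * (v : L2) x := by
    rw [Submodule.coe_inner, L2.inner_def]
    simp [mul_comm]
  have hnn : ∀ᵐ x : ℝ, 0 ≤ (u : L2) x * (v : L2) x := by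
    refine ae_of_ae_pos ?_ ?_
    · filter_upwards [hun, hvn, coeFn_eigenvector ha hlam hu] with x h1 h2 h3 hx
      by_cases hxξ : x ≤ ξ
      · exact (mul_pos_of_neg_of_neg (h1 ⟨hx, hxξ⟩) (h2 ⟨hx, hxξ⟩)).le
      · rw [h3, modConv_of_notMem fun h => hxξ h.2, mul_zero, zero_mul]
    · filter_upwards [(u.2 : ∀ᵐ x : ℝ, (u : L2) (-x) = -(u : L2) x),
        (v.2 : ∀ᵐ x : ℝ, (v : L2) (-x) = -(v : L2) x)] with x h1 h2 h3
      rwa [h1, h2, neg_mul_neg] at h3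
  rw [heq]
  refine lt_of_le_of_ne (integral_nonneg_of_ae hnn) fun h => not_ae_notMem_Ioc hξ ?_
  filter_upwards [(integral_eq_zero_iff_of_nonneg_ae hnn hint).1 h.symm, hun, hvn]
    with x h1 h2 h3 hx
  exact (mul_pos_of_neg_of_neg (h2 hx) (h3 hx)).ne' h1

theorem opA_negAbsOdd_eq {a : ℝ → ℝ} (ha : IsKernel a) {ξ lam : ℝ} (hξ : 0 < ξ)
    (hle : ∀ v : oddL2, ⟪opA a ha ξ v, v⟫ ≤ lam * ‖v‖ ^ 2) {u : oddL2}
    (hu : opA a ha ξ u = lam • u) : opA a ha ξ (negAbsOdd u) = lam • negAbsOdd u := by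
  refine apply_eq_smul_of_rayleigh_le ⟨opA a ha ξ, (isCompactOperator_opA ha ξ).continuous⟩
    (opA_isSymmetric ha ξ) hle ?_
  have hn : ‖negAbsOdd u‖ = ‖u‖ := norm_negAbs (u : L2)
  have h := inner_opA_le_negAbsOdd ha hξ u
  have hself : ⟪lam • u, u⟫ = lam * ⟪u, u⟫ := real_inner_smul_left u u lam
  rw [hu, hself, real_inner_self_eq_norm_sq, ← hn] at h
  exact h

/-- Eigenfunctions to the maximum of the Rayleigh quotient have a strict sign on `(0, ξ]`. -/
theorem eigenvector_sign {a : ℝ → ℝ} (ha : IsKernel a) {ξ lam : ℝ} (hξ : 0 < ξ)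
    (hlam : 0 < lam) (hle : ∀ v : oddL2, ⟪opA a ha ξ v, v⟫ ≤ lam * ‖v‖ ^ 2) {u : oddL2}
    (hu : opA a ha ξ u = lam • u) (hu0 : u ≠ 0) :
    (∀ᵐ x : ℝ, x ∈ Set.Ioc 0 ξ → (u : L2) x < 0) ∨
      ∀ᵐ x : ℝ, x ∈ Set.Ioc 0 ξ → ((-u : oddL2) : L2) x < 0 := by
  have hw := opA_negAbsOdd_eq ha hξ hle hu
  have hwpos : ∀ᵐ x : ℝ, 0 < x → (negAbsOdd u : L2) x = -|(u : L2) x| := negAbs_of_pos (u : L2)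
  by_cases h : negAbsOdd u = u
  · left
    refine eigenvector_ae_neg ha hlam hu hu0 ?_
    filter_upwards [hwpos] with x h1 hx
    rw [h] at h1
    rw [h1 hx]
    exact neg_nonpos.2 (abs_nonneg _)
  · right
    have hsub : ∀ᵐ x : ℝ, 0 < x →
        ((negAbsOdd u - u : oddL2) : L2) x = -|(u : L2) x| - (u : L2) x := by
      filter_upwards [hwpos, Lp.coeFn_sub (negAbsOdd u : L2) (u : L2)] with x h1 h2 hx
      rw [Submodule.coe_sub, h2, Pi.sub_apply, h1 hx]
    -- The difference is a nonzero eigenvector in the cone, so `-|u| - u < 0` on `(0, ξ]`, which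
    -- excludes `u ≤ 0`.
    have hneg := eigenvector_ae_neg ha hlam (v := negAbsOdd u - u)
      (by rw [map_sub, hw, hu, smul_sub]) (sub_ne_zero.2 h) (by
        filter_upwards [hsub] with x h1 hx
        rw [h1 hx]
        linarith [neg_abs_le ((u : L2) x)])
    filter_upwards [hneg, hsub, Lp.coeFn_neg (u : L2)] with x h1 h2 h3 hx
    have h4 := h1 hx
    rw [h2 hx.1] at h4
    rw [Submodule.coe_neg, h3, Pi.neg_apply]
    by_contra! h5
    rw [abs_of_nonpos (by linarith)] at h4
    linarith

/-- The eigenspace to the maximum of the Rayleigh quotient is spanned by any of its unit vectors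
that is negative on the half-line. -/
theorem eigenspace_eq_span {a : ℝ → ℝ} (ha : IsKernel a) {ξ lam : ℝ} (hξ : 0 < ξ)
    (hlam : 0 < lam) (hle : ∀ v : oddL2, ⟪opA a ha ξ v, v⟫ ≤ lam * ‖v‖ ^ 2) {v : oddL2}
    (hv : opA a ha ξ v = lam • v) (hv1 : ‖v‖ = 1)
    (hvn : ∀ᵐ x : ℝ, x ∈ Set.Ioc 0 ξ → (v : L2) x < 0) :
    (opA a ha ξ).eigenspace lam = Submodule.span ℝ {v} := by
  refine le_antisymm (fun u hu => ?_) ?_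
  · rw [Module.End.mem_eigenspace_iff] at hu
    -- The part of `u` orthogonal to `v` is again in the eigenspace. Were it nonzero, its strict
    -- sign would contradict orthogonality to `v`.
    set w := u - ⟪u, v⟫ • v with hw
    have hwe : opA a ha ξ w = lam • w := by
      rw [hw, map_sub, map_smul, hu, hv, smul_sub, smul_comm]
    have horth : ⟪w, v⟫ = 0 := by
      have hsmul : ⟪⟪u, v⟫ • v, v⟫ = ⟪u, v⟫ * ⟪v, v⟫ := real_inner_smul_left v v _
      rw [hw, inner_sub_left, hsmul, real_inner_self_eq_norm_sq, hv1]
      ring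
    have hw0 : w = 0 := by
      by_contra hne
      rcases eigenvector_sign ha hξ hlam hle hwe hne with h | h
      · exact (inner_eigenvectors_pos ha hξ hlam hwe h hvn).ne' horth
      · have h1 := inner_eigenvectors_pos ha hξ hlam (u := -w)
          (by rw [map_neg, hwe, smul_neg]) h hvn
        rw [inner_neg_left, horth, neg_zero] at h1
        exact lt_irrefl _ h1
    rw [Submodule.mem_span_singleton]
    exact ⟨⟪u, v⟫, (sub_eq_zero.1 hw0).symm⟩
  · rw [Submodule.span_singleton_le_iff_mem, Module.End.mem_eigenspace_iff]
    exact hv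

end KreinRutman

/-! ### Assembly of the main result -/

theorem proposition2p2 (a : ℝ → ℝ) (ha : KreinRutman.IsKernel a) (ξ : ℝ) (hξ : 0 < ξ) :
    ∃ lam : ℝ,
      IsGreatest {μ : ℝ | (KreinRutman.opA a ha ξ).HasEigenvalue μ} lam ∧
      Module.finrank ℝ ((KreinRutman.opA a ha ξ).maxGenEigenspace lam) = 1 ∧
      ∃ v : KreinRutman.oddL2,
        ((v : KreinRutman.L2) ∈ KreinRutman.coneNtilde ξ ∧ ‖v‖ = 1 ∧
          (KreinRutman.opA a ha ξ).eigenspace lam = Submodule.span ℝ {v}) ∧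
        ∀ w ∈ (KreinRutman.opA a ha ξ).eigenspace lam,
          (w : KreinRutman.L2) ∈ KreinRutman.coneNtilde ξ → ‖w‖ = 1 → w = v := by
  obtain ⟨u, hu⟩ := KreinRutman.exists_inner_opA_pos ha hξ
  obtain ⟨lam, hlam, ⟨v₁, hv₁, hTv₁⟩, hle⟩ := KreinRutman.exists_eigenvector_rayleigh_le
    ⟨KreinRutman.opA a ha ξ, (KreinRutman.isCompactOperator_opA ha ξ).continuous⟩
    (KreinRutman.isCompactOperator_opA ha ξ) (KreinRutman.opA_isSymmetric ha ξ) hu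
  change KreinRutman.opA a ha ξ v₁ = lam • v₁ at hTv₁
  change ∀ v, inner ℝ (KreinRutman.opA a ha ξ v) v ≤ lam * ‖v‖ ^ 2 at hle
  set w₁ := KreinRutman.negAbsOdd v₁ with hw₁
  have hw₁n : ‖w₁‖ = ‖v₁‖ := KreinRutman.norm_negAbs (v₁ : KreinRutman.L2)
  have hpos : 0 < ‖w₁‖ := by rwa [hw₁n, norm_pos_iff]
  have hTw₁ := KreinRutman.opA_negAbsOdd_eq ha hξ hle hTv₁
  set v := ‖w₁‖⁻¹ • w₁ with hv
  have hTv : KreinRutman.opA a ha ξ v = lam • v := by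
    rw [hv, map_smul, hTw₁, smul_comm]
  have hv1 : ‖v‖ = 1 := by
    rw [hv, norm_smul, norm_inv, norm_norm, inv_mul_cancel₀ hpos.ne']
  have hv0 : v ≠ 0 := by
    rintro h
    simp [h] at hv1
  have hvle : ∀ᵐ x : ℝ, 0 < x → (v : KreinRutman.L2) x ≤ 0 := by
    filter_upwards [KreinRutman.negAbs_of_pos (v₁ : KreinRutman.L2),
      Lp.coeFn_smul ‖w₁‖⁻¹ (w₁ : KreinRutman.L2)] with x h1 h2 hx
    rw [hv, Submodule.coe_smul, h2, Pi.smul_apply, smul_eq_mul]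
    refine mul_nonpos_of_nonneg_of_nonpos (inv_pos.2 hpos).le ?_
    exact (h1 hx).trans_le (neg_nonpos.2 (abs_nonneg _))
  have hvn := KreinRutman.eigenvector_ae_neg ha hlam hTv hv0 hvle
  have hspan := KreinRutman.eigenspace_eq_span ha hξ hlam hle hTv hv1 hvn
  refine ⟨lam, ⟨?_, ?_⟩, ?_, v, ⟨?_, hv1, hspan⟩, ?_⟩
  · exact Module.End.hasEigenvalue_of_hasEigenvector ⟨Module.End.mem_eigenspace_iff.2 hTv, hv0⟩
  · intro μ hμ
    obtain ⟨w, hw⟩ := Module.End.HasEigenvalue.exists_hasEigenvector hμ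
    have h := hle w
    rw [hw.apply_eq_smul, real_inner_smul_left, real_inner_self_eq_norm_sq] at h
    exact le_of_mul_le_mul_right h (pow_pos (norm_pos_iff.2 hw.2) 2)
  · rw [(KreinRutman.opA_isSymmetric ha ξ).isFinitelySemisimple.maxGenEigenspace_eq_eigenspace,
      hspan, finrank_span_singleton hv0]
  · exact KreinRutman.eigenvector_mem_coneNtilde ha hξ hlam hTv hv0 hvle
  · intro w hw hwN hw1
    rw [hspan, Submodule.mem_span_singleton] at hw
    obtain ⟨c, rfl⟩ := hw
    rw [norm_smul, hv1, mul_one, Real.norm_eq_abs] at hw1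
    -- The unit vectors of the line are `v` and `-v`, and `-v` is positive on `(0, ξ]`, hence
    -- outside the cone.
    rcases eq_or_eq_neg_of_abs_eq hw1 with rfl | rfl
    · rw [one_smul]
    · exfalso
      refine KreinRutman.not_ae_notMem_Ioc hξ ?_
      filter_upwards [hwN.1.2, hvn, Lp.coeFn_smul (-1 : ℝ) (v : KreinRutman.L2)]
        with x h1 h2 h3 hx
      have h4 := h1 hx.1
      rw [Submodule.coe_smul, h3, Pi.smul_apply, smul_eq_mul] at h4
      linarith [h2 hx]
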